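/- **Lemma (one step implementation cost for $U_1$).** Let $n\ge 1$, $L>0$, $h=L/(2^n-1)$, $\rho>0$, let $S_{\mathrm{comp}}\in\mathbb R^{6\times 6}$ be symmetric positive definite, and let $\tau\in\mathbb R$. On $\mathbb C^{16}$ (4 qubits, the state register) put $$A^{(\alpha)}=\begin{bmatrix}O_{3\times 3}&C^{(\alpha)}&O\\ (C^{(\alpha)})^{\mathsf T}&O_{6\times 6}&O\\ O&O&O_{7\times 7}\end{bmatrix},\qquad B_{\mathrm{cell}}=\begin{bmatrix}\rho I_3&O&O\\ O&S_{\mathrm{comp}}&O\\ O&O&I_7\end{bmatrix},$$ where $C^{(1)},C^{(2)},C^{(3)}$ are the $3\times 6$ matrices with entries $1$ at the positions $(1,1),(2,4),(3,5)$, resp. $(1,4),(2,2),(3,6)$, resp. $(1,5),(2,6),(3,3)$, and $0$ elsewhere. For $\alpha\in\{1,2,3\}$ let $(\phi_j^{(\alpha)})_{j=0}^{15}$ be any orthonormal basis of eigenvectors of $B_{\mathrm{cell}}^{-1/2}A^{(\alpha)}B_{\mathrm{cell}}^{-1/2}$, with eigenvalues $\lambda_j^{(\alpha)}\in\mathbb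 R$; let $P_j^{(\alpha)}=|\phi_j^{(\alpha)}\rangle\langle\phi_j^{(\alpha)}|$ and $V^{(\alpha)}=\sum_{j=0}^{15}|\phi_j^{(\alpha)}\rangle\langle j|$. The spatial register consists of $3n$ qubits, $n$ for each axis, and with $\sigma_{01}=|0\rangle\langle 1|$, $\sigma_{10}=|1\rangle\langle 0|$ let, for $1\le k\le n$, $$S_k^{\mathrm{cell}}=I^{\otimes(n-k)}\otimes\sigma_{01}\otimes\sigma_{10}^{\otimes(k-1)}-I^{\otimes(n-k)}\otimes\sigma_{10}\otimes\sigma_{01}^{\otimes(k-1)},\qquad S_k^{(\alpha)}=I^{\otimes n(\alpha-1)}\otimes S_k^{\mathrm{cell}}\otimes I^{\otimes n(3-\alpha)}.$$ Let $H_{jk}^{(\alpha)}=P_j^{(\alpha)}\otimes\frac{i\lambda_j^{(\alpha)}}{2h}S_k^{(\alpha)}$ and let $$U_1(\tau)=\prod_{\alpha=1}^{3}\prod_{j=0}^{15}\prod_{k=1}^{n}e^{-iH_{jk}^{(\alpha)}\tau}$$ be the first-order Trotter operator; in all products, factors with larger indices stand to the left. With $W_{jk}^{(\alpha)}(\tau)=\exp\bigl(\tfrac{\lambda_j^{(\alpha)}\tau}{2h}S_k^{(\alpha)}\bigr)$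 define the controlled blocks $$\Lambda_{jk}^{(\alpha)}(\tau)=|j\rangle\langle j|\otimes W_{jk}^{(\alpha)}(\tau)+\bigl(I^{\otimes 4}-|j\rangle\langle j|\bigr)\otimes I^{\otimes 3n}.$$ Then $$U_1(\tau)=\prod_{\alpha=1}^{3}\prod_{j=0}^{15}\Bigl[\bigl(V^{(\alpha)}\otimes I^{\otimes 3n}\bigr)\Bigl(\prod_{k=1}^{n}\Lambda_{jk}^{(\alpha)}(\tau)\Bigr)\bigl(V^{(\alpha)\dagger}\otimes I^{\otimes 3n}\bigr)\Bigr],$$ and $U_1(\tau)$ is implemented exactly, in this form, by a circuit of CNOT gates and arbitrary single-qubit gates on $3n+4$ qubits in total (4 for the state register, $3n$ for the spatial register, no ancillas) with at most $$432n^2+378$$ CNOT gates: for $\alpha=1,2,3$ in turn, the circuit is the concatenation of a circuit implementing $V^{(\alpha)\dagger}\otimes I^{\otimes 3n}$, a circuit implementing $\prod_{j=0}^{15}\prod_{k=1}^{n}\Lambda_{jk}^{(\alpha)}(\tau)$, and a circuit implementing $V^{(\alpha)}\otimes I^{\otimes 3n}$. -/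

import Mathlib

open scoped Matrix Kronecker

noncomputable section

namespace Elastic

/-! ### Gate-level circuits: arbitrary single-qubit unitaries and CNOT gates -/

/-- Computational basis of `N` qubits. -/
abbrev Bits (N : ℕ) := Fin N → Fin 2

/-- An elementary gate on `N` qubits: an arbitrary single-qubit unitary, or a CNOT. -/
inductive Gate (N : ℕ) where
  | single (q : Fin N) (U : Matrix.unitaryGroup (Fin 2) ℂ) : Gate N
  | cnot (c t : Fin N) (hct : c ≠ t) : Gate N

/-- The operator of a gate. A single-qubit gate acts on the tensor factor `q`; a CNOT sends `|y⟩`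
to `|y'⟩`, where `y'` is `y` with the target bit replaced by the sum mod 2 of target and control. -/
def Gate.toMatrix {N : ℕ} : Gate N → Matrix (Bits N) (Bits N) ℂ
  | .single q U => fun x y => if ∀ i, i ≠ q → x i = y i then U.1 (x q) (y q) else 0
  | .cnot c t _ => fun x y => if x = Function.update y t (y t + y c) then 1 else 0

/-- The number of CNOT gates of a gate: 1 for a CNOT, 0 for a single-qubit gate. -/
def Gate.cnots {N : ℕ} : Gate N → ℕ
  | .single _ _ => 0
  | .cnot _ _ _ => 1

/-- A circuit on `N` qubits (no further qubits are available); the head of the list is applied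
first. -/
abbrev Circuit (N : ℕ) := List (Gate N)

/-- The operator of a circuit: the last gate is the leftmost factor. -/
def Circuit.toMatrix {N : ℕ} (C : Circuit N) : Matrix (Bits N) (Bits N) ℂ :=
  (C.map Gate.toMatrix).reverse.prod

/-- The number of CNOT gates of a circuit. -/
def Circuit.cnotCount {N : ℕ} (C : Circuit N) : ℕ := (C.map Gate.cnots).sum

/-- The ordered product `F_{m-1} ⋯ F_1 F_0` (the factor with the largest index is leftmost). -/
def orderedProd {ι : Type*} [Fintype ι] [DecidableEq ι] {m : ℕ}
    (F : Fin m → Matrix ι ι ℂ) : Matrix ι ι ℂ :=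
  (List.ofFn F).reverse.prod

/-! ### Registers -/

/-- Computational basis `|j_x⟩|j_y⟩|j_z⟩` of the spatial register; each axis is a string of `n`
bits, the most significant bit first. -/
abbrev Spatial (n : ℕ) := Fin 3 → Fin n → Fin 2

/-- State register (4 qubits, basis `|0⟩, …, |15⟩`) and spatial register. -/
abbrev Reg (n : ℕ) := Fin 16 × Spatial n

/-- Qubits `0, …, 3` form the state register; they are followed by the `n` qubits of each axis. -/
def wireEquiv (n : ℕ) : Fin 4 ⊕ (Fin 3 × Fin n) ≃ Fin (3 * n + 4) :=
  ((Equiv.sumCongr (Equiv.refl (Fin 4)) finProdFinEquiv).trans finSumFinEquiv).trans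
    (finCongr (Nat.add_comm 4 (3 * n)))

/-- Binary expansion of `0, …, 15`, the most significant bit first. -/
def stateEquiv : (Fin 4 → Fin 2) ≃ Fin 16 :=
  ((Equiv.arrowCongr Fin.revPerm (Equiv.refl (Fin 2))).trans finFunctionFinEquiv).trans
    (finCongr (by norm_num))

/-- The computational basis of `3n + 4` qubits as the basis of the two registers. -/
def encode (n : ℕ) : Bits (3 * n + 4) ≃ Reg n :=
  ((Equiv.arrowCongr (wireEquiv n).symm (Equiv.refl (Fin 2))).trans
    (Equiv.sumArrowEquivProdArrow (Fin 4) (Fin 3 × Fin n) (Fin 2))).trans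
    (Equiv.prodCongr stateEquiv (Equiv.curry (Fin 3) (Fin n) (Fin 2)))

/-- The circuit `C` on `3n + 4` qubits implements the operator `U` exactly. -/
def Implements {n : ℕ} (C : Circuit (3 * n + 4)) (U : Matrix (Reg n) (Reg n) ℂ) : Prop :=
  Matrix.reindex (encode n) (encode n) C.toMatrix = U

/-! ### Spatial difference operators -/

def sigma01 : Matrix (Fin 2) (Fin 2) ℂ := !![0, 1; 0, 0]

def sigma10 : Matrix (Fin 2) (Fin 2) ℂ := !![0, 0; 1, 0]

/-- The tensor product `F_0 ⊗ F_1 ⊗ ⋯` of matrices, acting on functions on the index set. -/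
def tensor {ι X : Type*} [Fintype ι] (F : ι → Matrix X X ℂ) : Matrix (ι → X) (ι → X) ℂ :=
  fun x y => ∏ i, F i (x i) (y i)

/-- `I^{⊗(n-k)} ⊗ a ⊗ b^{⊗(k-1)}`, where `κ : Fin n` stands for `k = κ + 1`, so that the factor `a`
has the (zero-based) position `n - k`. -/
def ladder {n : ℕ} (κ : Fin n) (a b : Matrix (Fin 2) (Fin 2) ℂ) :
    Matrix (Fin n → Fin 2) (Fin n → Fin 2) ℂ :=
  tensor fun i => if i < Fin.rev κ then 1 else if i = Fin.rev κ then a else b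

/-- `S_k^cell = I^{⊗(n-k)} ⊗ σ₀₁ ⊗ σ₁₀^{⊗(k-1)} - I^{⊗(n-k)} ⊗ σ₁₀ ⊗ σ₀₁^{⊗(k-1)}`, `k = κ + 1`. -/
def Scell {n : ℕ} (κ : Fin n) : Matrix (Fin n → Fin 2) (Fin n → Fin 2) ℂ :=
  ladder κ sigma01 sigma10 - ladder κ sigma10 sigma01

/-- `S_k^{(α)}`: the operator `S_k^cell` on the axis `α`, the identity on the other axes. -/
def Saxis {n : ℕ} (α : Fin 3) (κ : Fin n) : Matrix (Spatial n) (Spatial n) ℂ :=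
  tensor fun β => if β = α then Scell κ else 1

/-- Grid spacing `h = L / (2^n - 1)`. -/
def spacing (n : ℕ) (L : ℝ) : ℝ := L / (2 ^ n - 1)

/-! ### Component matrices -/

/-- `C^{(1)}, C^{(2)}, C^{(3)}`. -/
def Cmat : Fin 3 → Matrix (Fin 3) (Fin 6) ℝ :=
  ![!![1, 0, 0, 0, 0, 0; 0, 0, 0, 1, 0, 0; 0, 0, 0, 0, 1, 0],
    !![0, 0, 0, 1, 0, 0; 0, 1, 0, 0, 0, 0; 0, 0, 0, 0, 0, 1],
    !![0, 0, 0, 0, 1, 0; 0, 0, 0, 0, 0, 1; 0, 0, 1, 0, 0, 0]]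

/-- The `16` components: 3 velocities, then 6 stresses, then 7 padding components. -/
def componentEquiv : (Fin 3 ⊕ Fin 6) ⊕ Fin 7 ≃ Fin 16 :=
  (Equiv.sumCongr finSumFinEquiv (Equiv.refl (Fin 7))).trans finSumFinEquiv

def Amat (α : Fin 3) : Matrix (Fin 16) (Fin 16) ℝ :=
  Matrix.reindex componentEquiv componentEquiv
    (Matrix.fromBlocks (Matrix.fromBlocks 0 (Cmat α) (Cmat α)ᵀ 0) 0 0 0)

def Bcell (ρ : ℝ) (S : Matrix (Fin 6) (Fin 6) ℝ) : Matrix (Fin 16) (Fin 16) ℝ :=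
  Matrix.reindex componentEquiv componentEquiv
    (Matrix.fromBlocks (Matrix.fromBlocks (ρ • (1 : Matrix (Fin 3) (Fin 3) ℝ)) 0 0 S) 0 0 1)

/-- `B_cell^{-1/2}`, by the functional calculus of symmetric matrices. -/
def BcellInvSqrt (ρ : ℝ) (S : Matrix (Fin 6) (Fin 6) ℝ) : Matrix (Fin 16) (Fin 16) ℝ :=
  cfc (fun x : ℝ => x ^ (-(1 / 2) : ℝ)) (Bcell ρ S)

/-- `B_cell^{-1/2} A^{(α)} B_cell^{-1/2}`, as a complex matrix. -/
def axisMatrix (ρ : ℝ) (S : Matrix (Fin 6) (Fin 6) ℝ) (α : Fin 3) :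
    Matrix (Fin 16) (Fin 16) ℂ :=
  (BcellInvSqrt ρ S * Amat α * BcellInvSqrt ρ S).map Complex.ofReal

/-- A choice, for each axis `α`, of an eigendecomposition of
`B_cell^{-1/2} A^{(α)} B_cell^{-1/2}`: an orthonormal basis of eigenvectors `φ_j^{(α)}` with real
eigenvalues `λ_j^{(α)}`. -/
structure Eigendecomposition (ρ : ℝ) (S : Matrix (Fin 6) (Fin 6) ℝ) where
  φ : Fin 3 → OrthonormalBasis (Fin 16) ℂ (EuclideanSpace ℂ (Fin 16))
  eig : Fin 3 → Fin 16 → ℝ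
  eigen : ∀ α j, axisMatrix ρ S α *ᵥ (φ α j).ofLp = (eig α j : ℂ) • (φ α j).ofLp

namespace Eigendecomposition

variable {ρ : ℝ} {S : Matrix (Fin 6) (Fin 6) ℝ} (E : Eigendecomposition ρ S)

/-- `P_j^{(α)} = |φ_j^{(α)}⟩⟨φ_j^{(α)}|`. -/
def P (α : Fin 3) (j : Fin 16) : Matrix (Fin 16) (Fin 16) ℂ :=
  Matrix.vecMulVec (E.φ α j).ofLp (star (E.φ α j).ofLp)

/-- `V^{(α)} = ∑_j |φ_j^{(α)}⟩⟨j|`, the matrix whose `j`-th column is `φ_j^{(α)}`. -/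
def V (α : Fin 3) : Matrix (Fin 16) (Fin 16) ℂ := fun i j => (E.φ α j).ofLp i

/-- `H_{jk}^{(α)} = P_j^{(α)} ⊗ (i λ_j^{(α)} / 2h) S_k^{(α)}`. -/
def H {n : ℕ} (L : ℝ) (α : Fin 3) (j : Fin 16) (κ : Fin n) : Matrix (Reg n) (Reg n) ℂ :=
  E.P α j ⊗ₖ ((Complex.I * ((E.eig α j / (2 * spacing n L) : ℝ) : ℂ)) • Saxis α κ)

/-- The first-order Trotter operator `U_1(τ) = ∏_α ∏_j ∏_k exp(-i H_{jk}^{(α)} τ)`. -/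
def U1 (n : ℕ) (L τ : ℝ) : Matrix (Reg n) (Reg n) ℂ :=
  orderedProd fun α : Fin 3 => orderedProd fun j : Fin 16 => orderedProd fun κ : Fin n =>
    NormedSpace.exp ((-(Complex.I * (τ : ℂ))) • E.H L α j κ)

/-- `θ_{jk}^{(α)}(τ) = λ_j^{(α)} τ / 2h`. -/
def θ (n : ℕ) (L τ : ℝ) (α : Fin 3) (j : Fin 16) : ℝ := E.eig α j * τ / (2 * spacing n L)

/-- `W_{jk}^{(α)}(τ) = exp(-i θ (i S_k^{(α)})) = exp(θ S_k^{(α)})` on the spatial register. -/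
def W {n : ℕ} (L τ : ℝ) (α : Fin 3) (j : Fin 16) (κ : Fin n) :
    Matrix (Spatial n) (Spatial n) ℂ :=
  NormedSpace.exp ((E.θ n L τ α j : ℂ) • Saxis α κ)

/-- The controlled block `|j⟩⟨j| ⊗ W_{jk}^{(α)}(τ) + (I - |j⟩⟨j|) ⊗ I`. -/
def block {n : ℕ} (L τ : ℝ) (α : Fin 3) (j : Fin 16) (κ : Fin n) : Matrix (Reg n) (Reg n) ℂ :=
  Matrix.single j j (1 : ℂ) ⊗ₖ E.W L τ α j κ + (1 - Matrix.single j j (1 : ℂ)) ⊗ₖ 1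

/-- The basis change `V^{(α)} ⊗ I` on the state register. -/
def basisChange (n : ℕ) (α : Fin 3) : Matrix (Reg n) (Reg n) ℂ := E.V α ⊗ₖ 1

/-- The basis change `V^{(α)†} ⊗ I` on the state register. -/
def basisChangeDagger (n : ℕ) (α : Fin 3) : Matrix (Reg n) (Reg n) ℂ := (E.V α)ᴴ ⊗ₖ 1

/-- `𝒲_j^{(α)}(τ) = (V^{(α)} ⊗ I) (∏_k block_{jk}^{(α)}) (V^{(α)†} ⊗ I)`. -/
def calW (n : ℕ) (L τ : ℝ) (α : Fin 3) (j : Fin 16) : Matrix (Reg n) (Reg n) ℂ :=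
  E.basisChange n α * (orderedProd fun κ : Fin n => E.block L τ α j κ) * E.basisChangeDagger n α

end Eigendecomposition

end Elastic

end

/-! Since `P_j = V |j⟩⟨j| V†` and `exp` commutes with conjugation, each Trotter factor is `(V ⊗ I)
Λ_jk (V† ⊗ I)`. Adjacent `V† V` cancel, so each axis needs only one pair of basis changes
(`U1_eq_orderedProd`). In the sector `|i⟩` of the state register only the blocks with `j = i` act.
Hence the `16 n` controlled blocks of an axis multiply to `n` operators `∑_j |j⟩⟨j| ⊗ W_jk`
(`orderedProd_block`), and the factor 16 enters only through a uniformly controlled rotation.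

To synthesize such an operator (`synth_stateDiag_exp`), CNOTs from the bit on which `σ₀₁` acts to
the `κ = k - 1` lower bits of the axis conjugate `S_k` to `σ₀₁ - σ₁₀` on that one bit, controlled by
all lower bits being 1. Its exponential is a plane rotation whose angle is selected by the 4 state
qubits and which has `κ` further controls. The further controls are handled by a Toffoli ladder on
borrowed qubits of another axis, restored at the end, so no ancilla is needed
(`synth_controlled_ucRotation`). The cost is `2 κ` for the CNOT fans, `2 * 2 ^ 4` for the rotations
and `24 κ` for the ladders; summed over `κ < n` this is `13 n² + 19 n`.

The basis changes are arbitrary 4-qubit unitaries. A recursive cosine-sine decomposition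
(`exists_cosine_sine`) reduces a unitary to uniformly controlled single-qubit gates. Each of these
costs `2 ^ 3 - 1` CNOTs up to a diagonal, the diagonals being pushed to the left and synthesized
once (`synth_unitary`). This gives `14 + 15 * 7 = 119` CNOTs.

An axis thus costs at most `2 * 119 + 13 n² + 19 n ≤ 144 n² + 126`, with equality at `n = 1`. -/

noncomputable section

namespace Elastic

/-! ### Synthesis of operators by circuits -/

section Synthesis

variable {N : ℕ}

/-- The operator `M` is implemented by a circuit with at most `k` CNOT gates. -/
def Synth (M : Matrix (Bits N) (Bits N) ℂ) (k : ℕ) : Prop :=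
  ∃ C : Circuit N, C.toMatrix = M ∧ C.cnotCount ≤ k

theorem Circuit.toMatrix_nil : Circuit.toMatrix ([] : Circuit N) = 1 := by
  simp [Circuit.toMatrix]

theorem Circuit.toMatrix_append (C D : Circuit N) :
    Circuit.toMatrix (C ++ D) = Circuit.toMatrix D * Circuit.toMatrix C := by
  simp [Circuit.toMatrix]

theorem Circuit.cnotCount_append (C D : Circuit N) :
    Circuit.cnotCount (C ++ D) = Circuit.cnotCount C + Circuit.cnotCount D := by
  simp [Circuit.cnotCount]

theorem Synth.one (k : ℕ) : Synth (1 : Matrix (Bits N) (Bits N) ℂ) k :=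
  ⟨[], Circuit.toMatrix_nil, by simp [Circuit.cnotCount]⟩

theorem Synth.mul {A B : Matrix (Bits N) (Bits N) ℂ} {a b : ℕ} (hA : Synth A a)
    (hB : Synth B b) : Synth (A * B) (a + b) := by
  obtain ⟨C, rfl, hC⟩ := hA
  obtain ⟨D, rfl, hD⟩ := hB
  refine ⟨D ++ C, Circuit.toMatrix_append _ _, ?_⟩
  rw [Circuit.cnotCount_append]
  omega

theorem Synth.mono {A : Matrix (Bits N) (Bits N) ℂ} {a b : ℕ} (hA : Synth A a) (h : a ≤ b) :
    Synth A b := by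
  obtain ⟨C, hC, hk⟩ := hA
  exact ⟨C, hC, hk.trans h⟩

theorem Synth.single (q : Fin N) (U : Matrix.unitaryGroup (Fin 2) ℂ) (k : ℕ) :
    Synth (Gate.single q U).toMatrix k :=
  ⟨[Gate.single q U], by simp [Circuit.toMatrix], by simp [Circuit.cnotCount, Gate.cnots]⟩

theorem Synth.cnot (c t : Fin N) (h : c ≠ t) : Synth (Gate.cnot c t h).toMatrix 1 :=
  ⟨[Gate.cnot c t h], by simp [Circuit.toMatrix], by simp [Circuit.cnotCount, Gate.cnots]⟩

/-! ### Uniformly controlled single-qubit operators -/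

/-- The operator acting on qubit `t` by the `2 × 2` matrix `f y` selected by the basis state `y`
of the other qubits. -/
def uc (t : Fin N) (f : Bits N → Matrix (Fin 2) (Fin 2) ℂ) : Matrix (Bits N) (Bits N) ℂ :=
  fun x y => if ∀ i, i ≠ t → x i = y i then f y (x t) (y t) else 0

theorem agree_off_iff {t : Fin N} {x y : Bits N} :
    (∀ i, i ≠ t → x i = y i) ↔ Function.update y t (x t) = x := by
  constructor
  · intro h
    ext1 i
    by_cases hi : i = t
    · subst hi; simp
    · simp [hi, h i hi]
  · intro h i hi
    rw [← h]
    simp [hi]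

theorem sum_eq_sum_update {M : Type*} [AddCommMonoid M] (t : Fin N) (y : Bits N)
    (F : Bits N → M) (h : ∀ z, ¬ (∀ i, i ≠ t → z i = y i) → F z = 0) :
    ∑ z, F z = ∑ b, F (Function.update y t b) := by
  symm
  refine Fintype.sum_of_injective (fun b => Function.update y t b)
    (Function.update_injective y t) _ _ ?_ (fun _ => rfl)
  intro z hz
  apply h
  intro hz'
  exact hz ⟨z t, agree_off_iff.1 hz'⟩

/-- The left factor reads its selector after the right factor has acted on qubit `t`, so `f` must
ignore that qubit. The selector of the right factor is read at the input and is unrestricted. -/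
theorem uc_mul (t : Fin N) {f : Bits N → Matrix (Fin 2) (Fin 2) ℂ} (hf : DependsOn f {t}ᶜ)
    (g : Bits N → Matrix (Fin 2) (Fin 2) ℂ) : uc t f * uc t g = uc t (fun y => f y * g y) := by
  ext x y
  rw [Matrix.mul_apply, sum_eq_sum_update t y]
  · have hfy : ∀ b, f (Function.update y t b) = f y := fun b => hf (by
      intro i hi
      have : i ≠ t := by simpa using hi
      simp [this])
    by_cases hxy : ∀ i, i ≠ t → x i = y i
    · have h1 : ∀ b, ∀ i, i ≠ t → x i = Function.update y t b i := by
        intro b i hi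
        simp [hi, hxy i hi]
      have h2 : ∀ b, ∀ i, i ≠ t → Function.update y t b i = y i := by
        intro b i hi
        simp [hi]
      simp only [uc, if_pos (h1 _), if_pos (h2 _), if_pos hxy, hfy, Function.update_self,
        Matrix.mul_apply]
    · have h1 : ∀ b, ¬ ∀ i, i ≠ t → x i = Function.update y t b i := by
        intro b h
        exact hxy fun i hi => by simpa [hi] using h i hi
      simp only [uc, if_neg (h1 _), if_neg hxy, zero_mul, Finset.sum_const_zero]
  · intro z hz
    simp only [uc, if_neg hz, mul_zero]

theorem uc_congr (t : Fin N) {f g : Bits N → Matrix (Fin 2) (Fin 2) ℂ} (h : ∀ y, f y = g y) :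
    uc t f = uc t g := by
  rw [funext h]

/-- Any qubit may serve as the target of a diagonal operator. This is what allows diagonals to be
absorbed into uniformly controlled gates on an arbitrary qubit. -/
theorem diagonal_eq_uc (t : Fin N) (d : Bits N → ℂ) :
    Matrix.diagonal d = uc t fun y => Matrix.diagonal fun b => d (Function.update y t b) := by
  ext x y
  by_cases hxy : x = y
  · subst hxy
    simp [uc]
  · rw [Matrix.diagonal_apply_ne _ hxy, uc]
    split_ifs with h
    · rw [Matrix.diagonal_apply_ne]
      intro h'
      apply hxy
      rw [← agree_off_iff.1 h, h']
      simp
    · rfl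

theorem uc_one (t : Fin N) : uc t (fun _ => (1 : Matrix (Fin 2) (Fin 2) ℂ)) = 1 := by
  simpa using (diagonal_eq_uc t fun _ => (1 : ℂ)).symm

theorem single_toMatrix (t : Fin N) (U : Matrix.unitaryGroup (Fin 2) ℂ) :
    (Gate.single t U).toMatrix = uc t fun _ => U.1 := rfl

/-- The Pauli matrix `X`. -/
def pauliX : Matrix (Fin 2) (Fin 2) ℂ := !![0, 1; 1, 0]

/-- The Pauli matrix `Z`. -/
def pauliZ : Matrix (Fin 2) (Fin 2) ℂ := !![1, 0; 0, -1]

/-- `X ^ b` for a bit `b`. -/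
def xpow (b : Fin 2) : Matrix (Fin 2) (Fin 2) ℂ := fun i j => if i = j + b then 1 else 0

theorem xpow_zero : xpow 0 = 1 := by
  ext i j
  simp [xpow, Matrix.one_apply]

theorem xpow_one : xpow 1 = pauliX := by
  ext i j
  fin_cases i <;> fin_cases j <;> simp [xpow, pauliX]

theorem xpow_mul (a b : Fin 2) : xpow a * xpow b = xpow (a + b) := by
  ext i j
  fin_cases a <;> fin_cases b <;> fin_cases i <;> fin_cases j <;>
    simp [xpow, Matrix.mul_apply]

theorem xpow_mul_self (a : Fin 2) : xpow a * xpow a = 1 := by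
  rw [xpow_mul, show a + a = 0 by revert a; decide, xpow_zero]

/-- The operator of the map `f` of basis states. -/
def permM (f : Bits N → Bits N) : Matrix (Bits N) (Bits N) ℂ := fun x y => if x = f y then 1 else 0

theorem Synth.congr_permM {f g : Bits N → Bits N} {k : ℕ} (h : Synth (permM f) k)
    (hfg : ∀ y, f y = g y) : Synth (permM g) k := by
  rwa [← funext hfg]

theorem permM_id : permM (N := N) (fun y => y) = 1 := by
  ext x y
  simp [permM, Matrix.one_apply]

theorem permM_mul (f g : Bits N → Bits N) : permM f * permM g = permM fun y => f (g y) := by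
  ext x y
  simp [permM, Matrix.mul_apply]

theorem cnot_toMatrix_eq_permM (c t : Fin N) (h : c ≠ t) :
    (Gate.cnot c t h).toMatrix = permM fun y => Function.update y t (y t + y c) := rfl

theorem permM_conj {f : Bits N → Bits N} (hf : ∀ y, f (f y) = y)
    (A : Matrix (Bits N) (Bits N) ℂ) :
    permM f * A * permM f = fun x y => A (f x) (f y) := by
  ext x y
  have h : ∀ z, (x = f z) ↔ z = f x := by
    intro z
    constructor
    · rintro rfl; exact (hf z).symm
    · rintro rfl; exact (hf x).symm
  simp [permM, Matrix.mul_apply, h]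

theorem permM_update_eq_uc (t : Fin N) (p : Bits N → Fin 2) :
    permM (fun y => Function.update y t (y t + p y)) = uc t fun y => xpow (p y) := by
  ext x y
  simp only [permM, uc, xpow]
  by_cases h : ∀ i, i ≠ t → x i = y i
  · rw [if_pos h]
    congr 1
    rw [← agree_off_iff.1 h]
    simp only [Function.update_self, eq_iff_iff]
    exact (Function.update_injective y t).eq_iff
  · rw [if_neg h, if_neg]
    rintro rfl
    exact h fun i hi => by simp [hi]

theorem cnot_toMatrix_eq_uc (c t : Fin N) (h : c ≠ t) :
    (Gate.cnot c t h).toMatrix = uc t fun y => xpow (y c) :=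
  permM_update_eq_uc t fun y => y c

theorem dependsOn_apply {s : Set (Fin N)} {c : Fin N} (hc : c ∈ s) :
    DependsOn (fun y : Bits N => y c) s := fun _ _ h => h c hc

theorem _root_.DependsOn.comp_left {α β : Type*} {s : Set (Fin N)} {f : Bits N → α}
    (hf : DependsOn f s) (g : α → β) : DependsOn (fun y => g (f y)) s :=
  fun _ _ h => congrArg g (hf h)

theorem _root_.DependsOn.comp_left₂ {α β γ : Type*} {s : Set (Fin N)} {f : Bits N → α} {g : Bits N → β}
    (hf : DependsOn f s) (hg : DependsOn g s) (k : α → β → γ) :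
    DependsOn (fun y => k (f y) (g y)) s :=
  fun _ _ h => congrArg₂ k (hf h) (hg h)

theorem _root_.DependsOn.update_insert {α : Type*} {s : Set (Fin N)} {c : Fin N} {f : Bits N → α}
    (hf : DependsOn f (insert c s)) (b : Fin 2) :
    DependsOn (fun y => f (Function.update y c b)) s := by
  intro x y h
  apply hf
  intro i hi
  by_cases hic : i = c
  · subst hic; simp
  · have : i ∈ s := by simpa [hic] using hi
    simp [hic, h i this]

/-! ### Uniformly controlled rotations -/

/-- A one-parameter group of single-qubit unitaries that is inverted by conjugation with `X`. -/
structure RotationFamily (R : ℝ → Matrix.unitaryGroup (Fin 2) ℂ) : Prop where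
  add : ∀ a b, (R (a + b)).1 = (R a).1 * (R b).1
  conj : ∀ a, xpow 1 * (R a).1 * xpow 1 = (R (-a)).1

theorem RotationFamily.conj_xpow {R : ℝ → Matrix.unitaryGroup (Fin 2) ℂ} (hR : RotationFamily R)
    (a : ℝ) (b : Fin 2) : xpow b * (R a).1 * xpow b = (R (if b = 0 then a else -a)).1 := by
  fin_cases b
  · simp [xpow_zero]
  · simpa using hR.conj a

theorem RotationFamily.zero {R : ℝ → Matrix.unitaryGroup (Fin 2) ℂ} (hR : RotationFamily R) :
    (R 0).1 = 1 := by
  have h := hR.add 0 0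
  rw [add_zero] at h
  have h2 : R 0 = R 0 * R 0 := Subtype.ext h
  have : R 0 = 1 := by simpa using h2
  rw [this]; rfl

/-- Uniformly controlled rotations, up to a fixed controlled power of `X` on the target. -/
theorem exists_synth_ucRotation_mul {R : ℝ → Matrix.unitaryGroup (Fin 2) ℂ}
    (hR : RotationFamily R) (t : Fin N) (s : Finset (Fin N)) (ht : t ∉ s) :
    ∃ p : Bits N → Fin 2, DependsOn p (s : Set (Fin N)) ∧ Synth (uc t fun y => xpow (p y)) 1 ∧
      ∀ θ : Bits N → ℝ, DependsOn θ (s : Set (Fin N)) →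
        Synth (uc t fun y => (R (θ y)).1 * xpow (p y)) (2 ^ s.card - 1) ∧
        Synth (uc t fun y => xpow (p y) * (R (θ y)).1) (2 ^ s.card - 1) := by
  induction s using Finset.induction_on with
  | empty =>
    refine ⟨fun _ => 0, dependsOn_const _ |>.mono (by simp), ?_, fun θ hθ => ?_⟩
    · simp only [xpow_zero, uc_one]
      exact Synth.one _
    · have h : ∀ y, θ y = θ 0 := fun y => hθ (by simp)
      simp only [xpow_zero, mul_one, one_mul, h, and_self]
      exact Synth.single t (R (θ 0)) _
  | insert c s hc ih =>
    simp only [Finset.mem_insert, not_or] at ht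
    have htc : c ≠ t := Ne.symm ht.1
    obtain ⟨p, hp, -, hrec⟩ := ih ht.2
    have hcn : Synth (uc t fun y : Bits N => xpow (y c)) 1 := by
      rw [← cnot_toMatrix_eq_uc c t htc]; exact Synth.cnot c t htc
    -- The leftover power of `X` is controlled by the newest control alone, hence is a single CNOT
    -- and does not depend on `θ`.
    refine ⟨fun y => y c, dependsOn_apply (by simp), hcn, fun θ hθ => ?_⟩
    rw [Finset.coe_insert] at hθ
    -- Half sum and half difference over the new control, so that `θ = a ± b` with the sign given by
    -- `y c`. Both depend only on the old controls.
    set a : Bits N → ℝ := fun y =>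
      (θ (Function.update y c 0) + θ (Function.update y c 1)) / 2 with ha
    set b : Bits N → ℝ := fun y =>
      (θ (Function.update y c 0) - θ (Function.update y c 1)) / 2 with hb
    have had : DependsOn a (s : Set (Fin N)) :=
      (hθ.update_insert 0).comp_left₂ (hθ.update_insert 1) fun u v => (u + v) / 2
    have hbd : DependsOn b (s : Set (Fin N)) :=
      (hθ.update_insert 0).comp_left₂ (hθ.update_insert 1) fun u v => (u - v) / 2
    have hst : (s : Set (Fin N)) ⊆ {t}ᶜ := by
      intro i hi
      simp only [Set.mem_compl_iff, Set.mem_singleton_iff]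
      rintro rfl
      exact ht.2 hi
    have hct : c ∈ ({t}ᶜ : Set (Fin N)) := by simpa using htc
    have hθab : ∀ y, θ y = a y + if y c = 0 then b y else -b y := by
      intro y
      have h1 : Function.update y c (y c) = y := by simp
      rcases (show y c = 0 ∨ y c = 1 by generalize y c = z; revert z; decide) with h | h
      · rw [h] at h1
        simp only [ha, hb, h, h1, if_true]
        ring
      · rw [h] at h1
        simp only [ha, hb, h, h1]
        norm_num
        ring
    -- Two recursive circuits enclose one CNOT, with their leftovers `X ^ p` facing inwards. Powers
    -- of `X` commute, so these leftovers cancel. The count is `2 * (2 ^ k - 1) + 1 = 2 ^ (k + 1) -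
    -- 1`.
    have key : ∀ u v : Bits N → ℝ, DependsOn u (s : Set (Fin N)) → DependsOn v (s : Set (Fin N)) →
        Synth (uc t fun y => (R (u y)).1 * xpow (y c) * (R (v y)).1)
          (2 ^ (insert c s).card - 1) := by
      intro u v hu hv
      have h1 := (hrec u hu).1
      have h2 := (hrec v hv).2
      have h3 := (h1.mul hcn).mul h2
      have hd1 : DependsOn (fun y => (R (u y)).1 * xpow (p y)) {t}ᶜ :=
        (hu.comp_left₂ hp fun u p => (R u).1 * xpow p).mono hst
      rw [uc_mul t hd1, uc_mul t] at h3
      · have he : ∀ y : Bits N, (R (u y)).1 * xpow (p y) * xpow (y c) * (xpow (p y) * (R (v y)).1)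
            = (R (u y)).1 * xpow (y c) * (R (v y)).1 := by
          intro y
          calc _ = (R (u y)).1 * (xpow (p y) * xpow (y c) * xpow (p y)) * (R (v y)).1 := by
                  simp only [mul_assoc]
            _ = _ := by
                  rw [xpow_mul, xpow_mul, show p y + y c + p y = y c by
                    generalize p y = i; generalize y c = j; revert i j; decide]
        simp only [he] at h3
        refine h3.mono ?_
        rw [Finset.card_insert_of_notMem hc, pow_succ]
        have : 0 < 2 ^ s.card := by positivity
        omega
      · exact hd1.comp_left₂ ((dependsOn_apply hct).comp_left xpow) (· * ·)
    constructor
    · refine (congrArg (Synth · _) (uc_congr t fun y => ?_)).mp (key a b had hbd)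
      rw [hθab y, hR.add, ← hR.conj_xpow (b y) (y c)]
      simp only [mul_assoc, xpow_mul_self, mul_one]
    · refine (congrArg (Synth · _) (uc_congr t fun y => ?_)).mp (key b a hbd had)
      rw [hθab y, add_comm, hR.add, ← hR.conj_xpow (b y) (y c)]
      simp only [← mul_assoc, xpow_mul_self, one_mul]

/-- One more gate of cost at most 1 removes the leftover `X ^ p`, which raises the count from `2 ^ k
- 1` to `2 ^ k`. -/
theorem synth_ucRotation {R : ℝ → Matrix.unitaryGroup (Fin 2) ℂ}
    (hR : RotationFamily R) (t : Fin N) (s : Finset (Fin N)) (ht : t ∉ s) (θ : Bits N → ℝ)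
    (hθ : DependsOn θ (s : Set (Fin N))) : Synth (uc t fun y => (R (θ y)).1) (2 ^ s.card) := by
  obtain ⟨p, hp, h1, h2⟩ := exists_synth_ucRotation_mul hR t s ht
  have h3 := (h2 θ hθ).1.mul h1
  have hst : (s : Set (Fin N)) ⊆ {t}ᶜ := by
    intro i hi
    simp only [Set.mem_compl_iff, Set.mem_singleton_iff]
    rintro rfl
    exact ht hi
  rw [uc_mul t ((hθ.comp_left₂ hp fun u p => (R u).1 * xpow p).mono hst)] at h3
  simp only [mul_assoc, xpow_mul_self, mul_one] at h3
  refine h3.mono ?_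
  have : 0 < 2 ^ s.card := by positivity
  omega

end Synthesis

/-! ### Cosine-sine decomposition -/

section CosineSine

variable {κ : Type*} [Fintype κ] [DecidableEq κ]

/-- The columns of `B` are orthogonal with norms `|s j|`. The nonzero ones, divided by `s j`, extend
to an orthonormal basis; the zero columns impose no condition. -/
theorem exists_unitary_mul_diagonal (B : Matrix κ κ ℂ) (s : κ → ℝ)
    (h : Bᴴ * B = Matrix.diagonal fun j => ((s j : ℝ) : ℂ) ^ 2) :
    ∃ Q ∈ Matrix.unitaryGroup κ ℂ, B = Q * Matrix.diagonal fun j => ((s j : ℝ) : ℂ) := by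
  set v : κ → EuclideanSpace ℂ κ := fun j =>
    ((s j : ℂ))⁻¹ • WithLp.toLp 2 (fun i => B i j) with hv
  have hB : ∀ i j, ∑ k, star (B k i) * B k j = if i = j then (s i : ℂ) ^ 2 else 0 := by
    intro i j
    have := congrFun (congrFun h i) j
    rw [Matrix.mul_apply, Matrix.diagonal_apply] at this
    simpa [Matrix.conjTranspose_apply] using this
  have horth : Orthonormal ℂ (Set.domRestrict {j | s j ≠ 0} v) := by
    rw [orthonormal_iff_ite]
    rintro ⟨i, hi⟩ ⟨j, hj⟩
    have hi' : (s i : ℂ) ≠ 0 := by simpa using hi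
    have hin : inner ℂ (v i) (v j) = (s i : ℂ)⁻¹ * (s j : ℂ)⁻¹ * ∑ k, star (B k i) * B k j := by
      simp only [hv, inner_smul_left, inner_smul_right, PiLp.inner_apply, RCLike.inner_apply]
      rw [← mul_assoc]
      simp [mul_comm]
    simp only [Set.domRestrict_apply, hin, hB, Subtype.mk.injEq]
    split_ifs with hij
    · subst hij
      field_simp
    · simp
  obtain ⟨b, hb⟩ := horth.exists_orthonormalBasis_extension_of_card_eq (by simp)
  refine ⟨Matrix.of fun i j => (b j).ofLp i, ?_, ?_⟩
  · rw [Matrix.mem_unitaryGroup_iff']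
    ext i j
    have := orthonormal_iff_ite.1 b.orthonormal i j
    rw [PiLp.inner_apply] at this
    rw [Matrix.mul_apply, Matrix.one_apply, ← this]
    refine Finset.sum_congr rfl fun k _ => ?_
    simp [Matrix.star_apply, mul_comm]
  · ext i j
    rw [Matrix.mul_diagonal]
    by_cases hj : s j = 0
    · have h0 := hB j j
      rw [if_pos rfl, hj] at h0
      have h1 : ∑ k, Complex.normSq (B k j) = 0 := by
        have : ((∑ k, Complex.normSq (B k j) : ℝ) : ℂ) = 0 := by
          push_cast
          rw [Complex.ofReal_zero, zero_pow two_ne_zero] at h0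
          rw [← h0]
          refine Finset.sum_congr rfl fun k _ => ?_
          rw [Complex.normSq_eq_conj_mul_self]; rfl
        exact_mod_cast this
      have h2 := (Finset.sum_eq_zero_iff_of_nonneg fun k _ => Complex.normSq_nonneg _).1 h1 i
        (Finset.mem_univ _)
      simp [hj, Complex.normSq_eq_zero.1 h2]
    · have hj' : (s j : ℂ) ≠ 0 := by simpa using hj
      rw [Matrix.of_apply, hb j hj]
      simp only [hv, PiLp.smul_apply, smul_eq_mul]
      field_simp

-- In an eigenbasis `Q` of `Gᴴ G` the columns of `G Q` are orthogonal, so the previous lemma applies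
-- with the square roots of the eigenvalues.
open scoped ComplexOrder in
theorem exists_singular_value_decomposition (G : Matrix κ κ ℂ) :
    ∃ L ∈ Matrix.unitaryGroup κ ℂ, ∃ R ∈ Matrix.unitaryGroup κ ℂ, ∃ s : κ → ℝ,
      (∀ j, 0 ≤ s j) ∧ G = L * (Matrix.diagonal fun j => ((s j : ℝ) : ℂ)) * R := by
  have hpos := Matrix.posSemidef_conjTranspose_mul_self G
  set D : Matrix κ κ ℂ := Matrix.diagonal (RCLike.ofReal ∘ hpos.1.eigenvalues) with hD
  set Q := hpos.1.eigenvectorUnitary with hQ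
  have hsp := hpos.1.spectral_theorem
  rw [Unitary.conjStarAlgAut_apply, ← hQ, ← hD] at hsp
  have hQQ : star Q.1 * Q.1 = 1 := Matrix.mem_unitaryGroup_iff'.1 Q.2
  have hQQ' : Q.1 * star Q.1 = 1 := Matrix.mem_unitaryGroup_iff.1 Q.2
  obtain ⟨L, hL, h⟩ := exists_unitary_mul_diagonal (G * Q.1)
    (fun j => Real.sqrt (hpos.1.eigenvalues j)) (by
      rw [Matrix.conjTranspose_mul]
      calc Q.1ᴴ * Gᴴ * (G * Q.1) = star Q.1 * (Gᴴ * G) * Q.1 := by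
            simp only [mul_assoc, Matrix.star_eq_conjTranspose]
        _ = (star Q.1 * Q.1) * D * (star Q.1 * Q.1) := by
            conv_lhs => rw [hsp]
            simp only [mul_assoc]
        _ = _ := by
            rw [hQQ, one_mul, mul_one, hD]
            congr 1
            ext j
            rw [← Complex.ofReal_pow, Real.sq_sqrt (hpos.eigenvalues_nonneg j)]
            rfl)
  refine ⟨L, hL, star Q.1, (star Q).2,
    fun j => Real.sqrt (hpos.1.eigenvalues j), fun j => Real.sqrt_nonneg _, ?_⟩
  rw [← h, mul_assoc, hQQ', mul_one]

/-- The planar rotation by the angle `θ`. -/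
def rot (θ : ℝ) : Matrix (Fin 2) (Fin 2) ℂ :=
  !![(Real.cos θ : ℂ), -(Real.sin θ : ℂ); (Real.sin θ : ℂ), (Real.cos θ : ℂ)]

/-- A singular value decomposition `A = L c R` forces `C Rᴴ` and `Bᴴ L` to have Gram matrix `1 - c²
= s²`, whence `C = Q s R` and `B = L s Q'ᴴ`. The remaining block is `c` wherever `s ≠ 0`. On the
kernel of `s` it is an arbitrary unitary, which has to be absorbed into the left factor of the
second block row. -/
theorem exists_cosine_sine_blocks (A B C D : Matrix κ κ ℂ)
    (h00 : Aᴴ * A + Cᴴ * C = 1) (h01 : Aᴴ * B + Cᴴ * D = 0)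
    (h11 : Bᴴ * B + Dᴴ * D = 1) (g00 : A * Aᴴ + B * Bᴴ = 1) (g01 : A * Cᴴ + B * Dᴴ = 0) :
    ∃ L₀ ∈ Matrix.unitaryGroup κ ℂ, ∃ L₁ ∈ Matrix.unitaryGroup κ ℂ,
    ∃ R₀ ∈ Matrix.unitaryGroup κ ℂ, ∃ R₁ ∈ Matrix.unitaryGroup κ ℂ, ∃ θ : κ → ℝ,
      A = L₀ * (Matrix.diagonal fun k => (Real.cos (θ k) : ℂ)) * R₀ ∧
      B = L₀ * (Matrix.diagonal fun k => -(Real.sin (θ k) : ℂ)) * R₁ ∧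
      C = L₁ * (Matrix.diagonal fun k => (Real.sin (θ k) : ℂ)) * R₀ ∧
      D = L₁ * (Matrix.diagonal fun k => (Real.cos (θ k) : ℂ)) * R₁ := by
  obtain ⟨L, hL, R, hR, c, hc, hA⟩ := exists_singular_value_decomposition A
  have hLL : Lᴴ * L = 1 := Matrix.mem_unitaryGroup_iff'.1 hL
  have hLL' : L * Lᴴ = 1 := Matrix.mem_unitaryGroup_iff.1 hL
  have hRR : Rᴴ * R = 1 := Matrix.mem_unitaryGroup_iff'.1 hR
  have hRR' : R * Rᴴ = 1 := Matrix.mem_unitaryGroup_iff.1 hR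
  set c' : Matrix κ κ ℂ := Matrix.diagonal fun j => ((c j : ℝ) : ℂ) with hc'
  have hc'H : c'ᴴ = c' := by
    rw [hc', Matrix.diagonal_conjTranspose]
    congr 1
    ext j
    simp
  have hC1 : (C * Rᴴ)ᴴ * (C * Rᴴ) = 1 - c' * c' := by
    have : Cᴴ * C = 1 - Aᴴ * A := by rw [← h00]; abel
    calc (C * Rᴴ)ᴴ * (C * Rᴴ) = R * (Cᴴ * C) * Rᴴ := by
          simp only [Matrix.conjTranspose_mul, Matrix.conjTranspose_conjTranspose, mul_assoc]
      _ = R * Rᴴ - (R * Rᴴ) * c' * (Lᴴ * L) * c' * (R * Rᴴ) := by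
          rw [this, hA]
          simp only [Matrix.conjTranspose_mul, hc'H, mul_sub, sub_mul, mul_assoc, mul_one]
      _ = _ := by rw [hRR', hLL]; simp
  have hB1 : (Bᴴ * L)ᴴ * (Bᴴ * L) = 1 - c' * c' := by
    have : B * Bᴴ = 1 - A * Aᴴ := by rw [← g00]; abel
    calc (Bᴴ * L)ᴴ * (Bᴴ * L) = Lᴴ * (B * Bᴴ) * L := by
          simp only [Matrix.conjTranspose_mul, Matrix.conjTranspose_conjTranspose, mul_assoc]
      _ = Lᴴ * L - (Lᴴ * L) * c' * (R * Rᴴ) * c' * (Lᴴ * L) := by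
          rw [this, hA]
          simp only [Matrix.conjTranspose_mul, hc'H, mul_sub, sub_mul, mul_assoc, mul_one]
      _ = _ := by rw [hRR', hLL]; simp
  have hdiag : (1 : Matrix κ κ ℂ) - c' * c' = Matrix.diagonal fun j => ((1 - c j ^ 2 : ℝ) : ℂ) := by
    rw [hc', Matrix.diagonal_mul_diagonal, ← Matrix.diagonal_one, Matrix.diagonal_sub]
    congr 1
    ext j
    push_cast
    ring
  have hc1 : ∀ j, c j ^ 2 ≤ 1 := by
    intro j
    have := congrFun (congrFun hC1 j) j
    rw [hdiag, Matrix.diagonal_apply_eq, Matrix.mul_apply] at this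
    have h2 : ((∑ k, Complex.normSq ((C * Rᴴ) k j) : ℝ) : ℂ) = ((1 - c j ^ 2 : ℝ) : ℂ) := by
      rw [← this, Complex.ofReal_sum]
      refine Finset.sum_congr rfl fun k _ => ?_
      rw [Complex.normSq_eq_conj_mul_self]; rfl
    have h3 : ∑ k, Complex.normSq ((C * Rᴴ) k j) = 1 - c j ^ 2 := by exact_mod_cast h2
    have h4 : 0 ≤ ∑ k, Complex.normSq ((C * Rᴴ) k j) :=
      Finset.sum_nonneg fun k _ => Complex.normSq_nonneg _
    linarith
  set θ : κ → ℝ := fun j => Real.arccos (c j) with hθ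
  have hcos : ∀ j, Real.cos (θ j) = c j := fun j =>
    Real.cos_arccos (by linarith [hc j]) (by nlinarith [hc j, hc1 j])
  set s : κ → ℝ := fun j => Real.sin (θ j) with hs
  have hsq : ∀ j, c j ^ 2 + s j ^ 2 = 1 := fun j => by
    rw [← hcos]; exact Real.cos_sq_add_sin_sq _
  have hdiag2 : (1 : Matrix κ κ ℂ) - c' * c' = Matrix.diagonal fun j => ((s j : ℝ) : ℂ) ^ 2 := by
    rw [hdiag]
    congr 1
    ext j
    rw [← hsq j]
    push_cast
    ring
  obtain ⟨Q, hQ, hCQ⟩ := exists_unitary_mul_diagonal _ s (hC1.trans hdiag2)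
  obtain ⟨Q', hQ', hBQ⟩ := exists_unitary_mul_diagonal _ s (hB1.trans hdiag2)
  have hQQ : Qᴴ * Q = 1 := Matrix.mem_unitaryGroup_iff'.1 hQ
  have hQQ' : Q * Qᴴ = 1 := Matrix.mem_unitaryGroup_iff.1 hQ
  have hPP : Q'ᴴ * Q' = 1 := Matrix.mem_unitaryGroup_iff'.1 hQ'
  have hPP' : Q' * Q'ᴴ = 1 := Matrix.mem_unitaryGroup_iff.1 hQ'
  set s' : Matrix κ κ ℂ := Matrix.diagonal fun j => ((s j : ℝ) : ℂ) with hs'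
  have hs'H : s'ᴴ = s' := by
    rw [hs', Matrix.diagonal_conjTranspose]
    congr 1
    ext j
    simp
  have hC : C = Q * s' * R := by
    rw [← hCQ, mul_assoc, hRR, mul_one]
  have hB : B = L * s' * Q'ᴴ := by
    have := congrArg Matrix.conjTranspose hBQ
    simp only [Matrix.conjTranspose_mul, Matrix.conjTranspose_conjTranspose, hs'H] at this
    rw [mul_assoc, ← this, ← mul_assoc, hLL', one_mul]
  -- `T` is `D` in the bases found so far. The sign accounts for the entry `-sin` of the rotation,
  -- which is later moved into `R₁ = -Q'ᴴ`.
  set T : Matrix κ κ ℂ := -(Qᴴ * D * Q') with hT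
  have hD : D = -(Q * T * Q'ᴴ) := by
    calc D = (Q * Qᴴ) * D * (Q' * Q'ᴴ) := by rw [hQQ', hPP', one_mul, mul_one]
      _ = _ := by rw [hT]; simp only [mul_neg, neg_mul, neg_neg, mul_assoc]
  have hcomm : c' * s' = s' * c' := by
    rw [hc', hs', Matrix.diagonal_mul_diagonal, Matrix.diagonal_mul_diagonal]
    congr 1; ext j; ring
  have hsT : s' * T = s' * c' := by
    have h := congrArg (fun M => R * M * Q') h01
    have e : R * (Aᴴ * B + Cᴴ * D) * Q' = (R * Rᴴ) * c' * (Lᴴ * L) * s' * (Q'ᴴ * Q')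
        - (R * Rᴴ) * s' * (Qᴴ * Q) * T * (Q'ᴴ * Q') := by
      rw [hA, hB, hC, hD]
      simp only [Matrix.conjTranspose_mul, hc'H, hs'H, mul_add, add_mul, mul_assoc, mul_neg,
        neg_mul, sub_eq_add_neg]
    simp only [e, hRR', hLL, hPP, hQQ, one_mul, mul_one, mul_zero, zero_mul, hcomm] at h
    exact (sub_eq_zero.1 h).symm
  have hTs : T * s' = s' * c' := by
    have h := congrArg (fun M => Lᴴ * M * Q) g01
    have e : Lᴴ * (A * Cᴴ + B * Dᴴ) * Q = (Lᴴ * L) * c' * (R * Rᴴ) * s' * (Qᴴ * Q)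
        - (Lᴴ * L) * s' * (Q'ᴴ * Q') * Tᴴ * (Qᴴ * Q) := by
      rw [hA, hB, hC, hD]
      simp only [Matrix.conjTranspose_mul, Matrix.conjTranspose_neg,
        Matrix.conjTranspose_conjTranspose, hs'H, mul_add, add_mul, mul_assoc, mul_neg,
        neg_mul, sub_eq_add_neg]
    simp only [e, hRR', hLL, hPP, hQQ, one_mul, mul_one, mul_zero, zero_mul] at h
    have h2 := congrArg Matrix.conjTranspose (sub_eq_zero.1 h)
    simp only [Matrix.conjTranspose_mul, Matrix.conjTranspose_conjTranspose, hs'H, hc'H] at h2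
    exact h2.symm
  have hTT : Tᴴ * T = c' * c' := by
    have h := congrArg (fun M => Q'ᴴ * M * Q') h11
    have e : Q'ᴴ * (Bᴴ * B + Dᴴ * D) * Q' = (Q'ᴴ * Q') * s' * (Lᴴ * L) * s' * (Q'ᴴ * Q')
        + (Q'ᴴ * Q') * Tᴴ * (Qᴴ * Q) * T * (Q'ᴴ * Q') := by
      rw [hB, hD]
      simp only [Matrix.conjTranspose_mul, Matrix.conjTranspose_neg,
        Matrix.conjTranspose_conjTranspose, hs'H, mul_add, add_mul, mul_assoc, mul_neg,
        neg_mul, neg_neg]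
    simp only [e, hLL, hPP, hQQ, one_mul, mul_one] at h
    have h3 : s' * s' = 1 - c' * c' := by
      rw [hdiag2, hs', Matrix.diagonal_mul_diagonal]
      congr 1; ext j; ring
    rw [h3] at h
    calc Tᴴ * T = (1 - c' * c' + Tᴴ * T) - (1 - c' * c') := by abel
      _ = c' * c' := by rw [h]; abel
  have hcol : ∀ i j, s j ≠ 0 → T i j = c' i j := by
    intro i j hj
    have h := congrFun (congrFun hTs i) j
    rw [hs', Matrix.mul_diagonal, Matrix.diagonal_mul, hc'] at h
    have hj' : ((s j : ℝ) : ℂ) ≠ 0 := by exact_mod_cast hj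
    rw [hc']
    by_cases hij : i = j
    · subst hij
      rw [Matrix.diagonal_apply_eq] at h ⊢
      rw [mul_comm] at h
      exact mul_left_cancel₀ hj' h
    · rw [Matrix.diagonal_apply_ne _ hij] at h ⊢
      rw [mul_zero] at h
      exact (mul_eq_zero.1 h).resolve_right hj'
  have hcone : ∀ j, s j = 0 → c j = 1 := by
    intro j hj
    have := hsq j
    rw [hj] at this
    nlinarith [hc j]
  have hT1 : T * (1 - c') = c' * (1 - c') := by
    have h1 : (1 : Matrix κ κ ℂ) - c' = Matrix.diagonal fun j => 1 - ((c j : ℝ) : ℂ) := by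
      rw [hc', ← Matrix.diagonal_one, Matrix.diagonal_sub]
    ext i j
    rw [h1, Matrix.mul_diagonal, Matrix.mul_diagonal]
    by_cases hj : s j = 0
    · simp [hcone j hj]
    · rw [hcol i j hj]
  have hTc : T * c' = T - c' * (1 - c') := by
    rw [← hT1]
    simp only [mul_sub, mul_one]
    abel
  have hT1' : (1 - c') * Tᴴ = c' * (1 - c') := by
    have := congrArg Matrix.conjTranspose hT1
    simp only [Matrix.conjTranspose_mul, Matrix.conjTranspose_sub, Matrix.conjTranspose_one,
      hc'H] at this
    rw [this]
    simp only [mul_sub, sub_mul, mul_one, one_mul]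
  have hsT' : s' * Tᴴ = s' * c' := by
    have := congrArg Matrix.conjTranspose hTs
    simp only [Matrix.conjTranspose_mul, hs'H, hc'H] at this
    rw [this, hcomm]
  have hTc1 : Tᴴ * (1 - c') = c' * (1 - c') := by
    have h1 : (1 : Matrix κ κ ℂ) - c' = Matrix.diagonal fun j => 1 - ((c j : ℝ) : ℂ) := by
      rw [hc', ← Matrix.diagonal_one, Matrix.diagonal_sub]
    ext i j
    rw [h1, Matrix.mul_diagonal, Matrix.mul_diagonal]
    by_cases hj : s j = 0
    · simp [hcone j hj]
    · have hj' : ((s j : ℝ) : ℂ) ≠ 0 := by exact_mod_cast hj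
      have h := congrFun (congrFun hsT j) i
      rw [hs', Matrix.diagonal_mul, Matrix.diagonal_mul] at h
      rw [Matrix.conjTranspose_apply, mul_left_cancel₀ hj' h, ← Matrix.conjTranspose_apply, hc'H]
  have hTc2 : (1 - c') * T = c' * (1 - c') := by
    have := congrArg Matrix.conjTranspose hTc1
    simp only [Matrix.conjTranspose_mul, Matrix.conjTranspose_sub, Matrix.conjTranspose_one,
      hc'H, Matrix.conjTranspose_conjTranspose] at this
    rw [this]
    simp only [mul_sub, sub_mul, mul_one, one_mul]
  -- This matrix is the identity where `s ≠ 0` and equals `T` where `s = 0`, since `c = 1` there. It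
  -- satisfies `W s = s` and `W c = T`, so replacing `Q` by `Q W` leaves `C` unchanged and turns `D`
  -- into the required form.
  have hW : T + (1 - c') ∈ Matrix.unitaryGroup κ ℂ := by
    rw [Matrix.mem_unitaryGroup_iff']
    have : star (T + (1 - c')) = Tᴴ + (1 - c') := by
      rw [Matrix.star_eq_conjTranspose, Matrix.conjTranspose_add, Matrix.conjTranspose_sub,
        Matrix.conjTranspose_one, hc'H]
    rw [this, add_mul, mul_add, mul_add, hTT, hTc1, hTc2]
    noncomm_ring
  have hnQ' : -Q'ᴴ ∈ Matrix.unitaryGroup κ ℂ := by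
    rw [Matrix.mem_unitaryGroup_iff', Matrix.star_eq_conjTranspose, Matrix.conjTranspose_neg,
      Matrix.conjTranspose_conjTranspose, neg_mul_neg, hPP']
  have hcosd : (Matrix.diagonal fun k => (Real.cos (θ k) : ℂ)) = c' := by
    rw [hc']; congr 1; ext j; rw [hcos]
  have hsind : (Matrix.diagonal fun k => (Real.sin (θ k) : ℂ)) = s' := rfl
  have hnsind : (Matrix.diagonal fun k => -(Real.sin (θ k) : ℂ)) = -s' := by
    rw [hs', Matrix.diagonal_neg]
  refine ⟨L, hL, Q * (T + (1 - c')), mul_mem hQ hW, R, hR, -Q'ᴴ, hnQ', θ, ?_, ?_, ?_, ?_⟩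
  · rw [hcosd]; exact hA
  · rw [hnsind, hB]
    simp
  · rw [hsind, hC]
    congr 1
    rw [mul_assoc]
    congr 1
    rw [add_mul, hTs, sub_mul, one_mul, hcomm]
    abel
  · rw [hcosd, hD]
    simp only [mul_neg, neg_inj]
    congr 1
    rw [mul_assoc]
    congr 1
    rw [add_mul, hTc, sub_mul, one_mul, mul_sub, mul_one]
    abel

/-- Cosine-sine decomposition of a unitary operator on `ℂ² ⊗ ℂ^κ`, in coordinates. -/
theorem exists_cosine_sine (U : Matrix (Fin 2 × κ) (Fin 2 × κ) ℂ)
    (hU : U ∈ Matrix.unitaryGroup (Fin 2 × κ) ℂ) :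
    ∃ L R : Fin 2 → Matrix.unitaryGroup κ ℂ, ∃ θ : κ → ℝ, ∀ i a j b,
      U (i, a) (j, b) = ∑ k, (L i).1 a k * rot (θ k) i j * (R j).1 k b := by
  have h1 := Matrix.mem_unitaryGroup_iff'.1 hU
  have h2 := Matrix.mem_unitaryGroup_iff.1 hU
  set W : Fin 2 → Fin 2 → Matrix κ κ ℂ := fun i j a b => U (i, a) (j, b) with hW
  have e1 : ∀ i j, (W 0 i)ᴴ * W 0 j + (W 1 i)ᴴ * W 1 j = if i = j then 1 else 0 := by
    intro i j
    ext a b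
    have := congrFun (congrFun h1 (i, a)) (j, b)
    rw [Matrix.mul_apply, Fintype.sum_prod_type, Fin.sum_univ_two, Matrix.one_apply] at this
    rw [Matrix.add_apply, Matrix.mul_apply, Matrix.mul_apply]
    refine Eq.trans this ?_
    by_cases hij : i = j <;> simp [hij, Matrix.one_apply]
  have e2 : ∀ i j, W i 0 * (W j 0)ᴴ + W i 1 * (W j 1)ᴴ = if i = j then 1 else 0 := by
    intro i j
    ext a b
    have := congrFun (congrFun h2 (i, a)) (j, b)
    rw [Matrix.mul_apply, Fintype.sum_prod_type, Fin.sum_univ_two, Matrix.one_apply] at this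
    rw [Matrix.add_apply, Matrix.mul_apply, Matrix.mul_apply]
    refine Eq.trans this ?_
    by_cases hij : i = j <;> simp [hij, Matrix.one_apply]
  obtain ⟨L₀, hL₀, L₁, hL₁, R₀, hR₀, R₁, hR₁, θ, hA, hB, hC, hD⟩ :=
    exists_cosine_sine_blocks (W 0 0) (W 0 1) (W 1 0) (W 1 1)
      (by simpa using e1 0 0) (by simpa using e1 0 1) (by simpa using e1 1 1)
      (by simpa using e2 0 0) (by simpa using e2 0 1)
  refine ⟨![⟨L₀, hL₀⟩, ⟨L₁, hL₁⟩], ![⟨R₀, hR₀⟩, ⟨R₁, hR₁⟩], θ, fun i a j b => ?_⟩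
  have key : ∀ (L R : Matrix κ κ ℂ) (d : κ → ℂ),
      (L * Matrix.diagonal d * R) a b = ∑ k, L a k * d k * R k b := by
    intro L R d
    rw [Matrix.mul_apply]
    simp only [Matrix.mul_diagonal]
  fin_cases i <;> fin_cases j
  · exact (congrFun (congrFun hA a) b).trans (key _ _ _)
  · exact (congrFun (congrFun hB a) b).trans (key _ _ _)
  · exact (congrFun (congrFun hC a) b).trans (key _ _ _)
  · exact (congrFun (congrFun hD a) b).trans (key _ _ _)

end CosineSine

/-! ### Diagonal operators and uniformly controlled unitaries -/

section Unitaries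

variable {N : ℕ}

/-- The diagonal single-qubit unitary with the entries `d`. -/
def phaseGate (d : Fin 2 → Circle) : Matrix.unitaryGroup (Fin 2) ℂ :=
  ⟨Matrix.diagonal fun b => (d b : ℂ), by
    rw [Matrix.mem_unitaryGroup_iff', Matrix.star_eq_conjTranspose, Matrix.diagonal_conjTranspose,
      Matrix.diagonal_mul_diagonal, ← Matrix.diagonal_one]
    congr 1
    ext b
    simp [← Circle.coe_inv_eq_conj]⟩

theorem phaseGate_val (d : Fin 2 → Circle) :
    (phaseGate d).1 = Matrix.diagonal fun b => (d b : ℂ) := rfl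

/-- `exp(iθZ)`. -/
def rotZ (θ : ℝ) : Matrix.unitaryGroup (Fin 2) ℂ := phaseGate ![Circle.exp θ, Circle.exp (-θ)]

theorem rotationFamily_rotZ : RotationFamily rotZ where
  add a b := by
    simp only [rotZ, phaseGate_val, Matrix.diagonal_mul_diagonal]
    congr 1
    ext i
    fin_cases i
    · simp
    · simp [mul_comm]
  conj a := by
    rw [xpow_one, rotZ, rotZ, phaseGate_val, phaseGate_val]
    ext i j
    fin_cases i <;> fin_cases j <;>
      simp [pauliX, Matrix.mul_apply, Matrix.vecMul_diagonal]

theorem diagonal_mul_uc (t : Fin N) (d : Bits N → ℂ) (f : Bits N → Matrix (Fin 2) (Fin 2) ℂ) :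
    Matrix.diagonal d * uc t f =
      uc t fun y => (Matrix.diagonal fun b => d (Function.update y t b)) * f y := by
  ext x y
  rw [Matrix.diagonal_mul, uc, uc]
  split_ifs with h
  · rw [Matrix.diagonal_mul, agree_off_iff.1 h]
  · rw [mul_zero]

theorem uc_mul_diagonal (t : Fin N) (d : Bits N → ℂ) (f : Bits N → Matrix (Fin 2) (Fin 2) ℂ) :
    uc t f * Matrix.diagonal d =
      uc t fun y => f y * (Matrix.diagonal fun b => d (Function.update y t b)) := by
  ext x y
  rw [Matrix.mul_diagonal, uc, uc]
  split_ifs with h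
  · rw [Matrix.mul_diagonal, Function.update_eq_self]
  · rw [zero_mul]

/-- A diagonal unitary on a nonempty set of qubits. -/
theorem synth_diagonal (s : Finset (Fin N)) (hs : s.Nonempty) (d : Bits N → Circle)
    (hd : DependsOn d (s : Set (Fin N))) :
    Synth (Matrix.diagonal fun y => (d y : ℂ)) (2 ^ s.card - 2) := by
  induction hs using Finset.Nonempty.cons_induction generalizing d with
  | singleton a =>
    rw [diagonal_eq_uc a]
    have h : ∀ y b, d (Function.update y a b) = d (Function.update 0 a b) := by
      intro y b
      apply hd
      intro i hi
      simp only [Finset.coe_singleton, Set.mem_singleton_iff] at hi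
      subst hi
      simp
    simp only [h]
    exact Synth.single a (phaseGate fun b => d (Function.update 0 a b)) _
  | cons t s ht hs ih =>
    set g : Bits N → ℝ := fun y => Complex.arg (d y) with hg
    have hgd : ∀ y, Circle.exp (g y) = d y := fun y => Circle.exp_arg _
    have hgs : DependsOn g (insert t (s : Set (Fin N))) := by
      rw [Finset.coe_cons] at hd
      exact hd.comp_left fun z => Complex.arg z
    set a : Bits N → ℝ := fun y =>
      (g (Function.update y t 0) + g (Function.update y t 1)) / 2 with ha
    set b : Bits N → ℝ := fun y =>
      (g (Function.update y t 0) - g (Function.update y t 1)) / 2 with hb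
    have had : DependsOn a (s : Set (Fin N)) :=
      (hgs.update_insert 0).comp_left₂ (hgs.update_insert 1) fun u v => (u + v) / 2
    have hbd : DependsOn b (s : Set (Fin N)) :=
      (hgs.update_insert 0).comp_left₂ (hgs.update_insert 1) fun u v => (u - v) / 2
    -- The mean phase over the two values of qubit `t` is a diagonal on the other qubits; the half
    -- difference is a uniformly controlled rotation about `Z`. The count is `(2 ^ k - 2) + 2 ^ k =
    -- 2 ^ (k + 1) - 2`.
    have h1 := ih (fun y => Circle.exp (a y)) (had.comp_left _)
    have h2 := synth_ucRotation rotationFamily_rotZ t s ht b hbd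
    have h3 := h1.mul h2
    rw [diagonal_mul_uc] at h3
    have e : (Matrix.diagonal fun y => (d y : ℂ)) = uc t fun y =>
        (Matrix.diagonal fun c => ((Circle.exp (a (Function.update y t c)) : Circle) : ℂ)) *
          (rotZ (b y)).1 := by
      rw [diagonal_eq_uc t]
      refine uc_congr t fun y => ?_
      rw [rotZ, phaseGate_val, Matrix.diagonal_mul_diagonal]
      congr 1
      ext c
      rw [← hgd, ← Circle.coe_mul]
      congr 1
      fin_cases c
      · change _ = Circle.exp (a _) * Circle.exp (b y)
        rw [← Circle.exp_add]
        congr 1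
        simp only [ha, hb, Function.update_idem, Fin.zero_eta]
        ring
      · change _ = Circle.exp (a _) * Circle.exp (-b y)
        rw [← Circle.exp_add]
        congr 1
        simp only [ha, hb, Function.update_idem, Fin.mk_one]
        ring
    rw [e]
    refine h3.mono ?_
    rw [Finset.card_cons, pow_succ]
    have : 2 ≤ 2 ^ s.card := by
      calc 2 = 2 ^ 1 := rfl
        _ ≤ _ := Nat.pow_le_pow_right (by norm_num) hs.card_pos
    omega

/-- The planar rotation as a unitary. -/
def rotU (θ : ℝ) : Matrix.unitaryGroup (Fin 2) ℂ :=
  ⟨rot θ, by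
    have h : ((Real.cos θ : ℂ)) * Real.cos θ + Real.sin θ * Real.sin θ = 1 := by
      have := Real.cos_sq_add_sin_sq θ
      rw [sq, sq] at this
      exact_mod_cast this
    rw [Matrix.mem_unitaryGroup_iff']
    ext i j
    fin_cases i <;> fin_cases j <;>
      simp [rot, Matrix.mul_apply, Fin.sum_univ_two, Matrix.star_apply, -Complex.ofReal_cos,
        -Complex.ofReal_sin, h, mul_comm]
    rw [add_comm, h]⟩

theorem exists_circle_of_unitary_unit (l : Matrix.unitaryGroup Unit ℂ) :
    ∃ z : Circle, l.1 () () = z := by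
  have h := Matrix.mem_unitaryGroup_iff'.1 l.2
  have h2 : star (l.1 () ()) * l.1 () () = 1 := by
    have := congrFun (congrFun h ()) ()
    rwa [Matrix.mul_apply, Fintype.sum_unique, Matrix.one_apply_eq] at this
  refine ⟨⟨l.1 () (), ?_⟩, rfl⟩
  refine mem_sphere_zero_iff_norm.2 ?_
  rw [← pow_left_inj₀ (norm_nonneg _) zero_le_one two_ne_zero, one_pow,
    ← Complex.normSq_eq_norm_sq]
  have := Complex.normSq_eq_conj_mul_self (z := l.1 () ())
  rw [show (starRingEnd ℂ) (l.1 () ()) = star (l.1 () ()) from rfl, h2] at this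
  exact_mod_cast this

theorem reindex_mem_unitaryGroup {ι κ : Type*} [Fintype ι] [Fintype κ] [DecidableEq ι]
    [DecidableEq κ] (e : ι ≃ κ) {U : Matrix ι ι ℂ} (hU : U ∈ Matrix.unitaryGroup ι ℂ) :
    Matrix.reindex e e U ∈ Matrix.unitaryGroup κ ℂ := by
  rw [Matrix.mem_unitaryGroup_iff', Matrix.star_eq_conjTranspose, Matrix.conjTranspose_reindex,
    Matrix.reindex_apply, Matrix.reindex_apply, Matrix.submatrix_mul_equiv,
    ← Matrix.star_eq_conjTranspose, Matrix.mem_unitaryGroup_iff'.1 hU,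
    Matrix.submatrix_one_equiv]

/-- Euler angles, obtained as the cosine-sine decomposition with a one-dimensional second factor,
where the outer unitaries are phases. -/
theorem exists_phase_rot_phase (X : Matrix.unitaryGroup (Fin 2) ℂ) :
    ∃ (p q : Fin 2 → Circle) (θ : ℝ), X = phaseGate p * rotU θ * phaseGate q := by
  obtain ⟨L, R, θ, h⟩ := exists_cosine_sine (κ := Unit)
    (Matrix.reindex (Equiv.prodUnique (Fin 2) Unit).symm (Equiv.prodUnique (Fin 2) Unit).symm X.1)
    (reindex_mem_unitaryGroup _ X.2)
  choose l hl using fun i => exists_circle_of_unitary_unit (L i)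
  choose r hr using fun i => exists_circle_of_unitary_unit (R i)
  refine ⟨l, r, θ (), Subtype.ext ?_⟩
  ext i j
  have := h i () j ()
  simp only [Finset.univ_unique, PUnit.default_eq_unit, Finset.sum_singleton, hl, hr] at this
  simp only [Submonoid.coe_mul, phaseGate_val, Matrix.mul_diagonal, Matrix.diagonal_mul]
  exact this

/-- The Pauli matrix `Z` as a unitary. -/
def gateZ : Matrix.unitaryGroup (Fin 2) ℂ := phaseGate ![1, -1]

/-- Conjugation by `Z` inverts a plane rotation, so half of the angle can be moved across `Z` to its
other side. -/
theorem rot_half_Z (θ : ℝ) :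
    rotU θ * gateZ = rotU (θ / 2) * gateZ * star (rotU (θ / 2)) := by
  have hc : Real.cos θ = Real.cos (θ / 2) ^ 2 - Real.sin (θ / 2) ^ 2 := by
    rw [← Real.cos_two_mul']; congr 1; ring
  have hs : Real.sin θ = 2 * Real.sin (θ / 2) * Real.cos (θ / 2) := by
    rw [← Real.sin_two_mul]; congr 1; ring
  apply Subtype.ext
  simp only [Submonoid.coe_mul, Unitary.coe_star, rotU, rot, gateZ, phaseGate_val, hc, hs]
  ext i j
  fin_cases i <;> fin_cases j <;>
    simp [Matrix.mul_apply, Fin.sum_univ_two, Matrix.star_apply, Matrix.vecMul_diagonal,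
        -Complex.ofReal_cos, -Complex.ofReal_sin] <;> ring

/-- Demultiplexing of two single-qubit unitaries, up to diagonal phases. -/
theorem exists_demultiplex (a b : Matrix.unitaryGroup (Fin 2) ℂ) :
    ∃ (p q : Fin 2 → Circle) (u v : Matrix.unitaryGroup (Fin 2) ℂ),
      a = phaseGate p * v * u ∧ b = phaseGate q * v * gateZ * u := by
  obtain ⟨p, q, θ, h⟩ := exists_phase_rot_phase (a * star b)
  have hzz : gateZ * gateZ = 1 := by
    apply Subtype.ext
    simp only [gateZ, Submonoid.coe_mul, phaseGate_val, Matrix.diagonal_mul_diagonal]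
    rw [Submonoid.coe_one, ← Matrix.diagonal_one]
    congr 1
    ext i
    fin_cases i <;> simp
  have hst : ∀ z : Matrix.unitaryGroup (Fin 2) ℂ, star z = z⁻¹ := fun z => rfl
  have hinv : gateZ⁻¹ = gateZ := inv_eq_of_mul_eq_one_left hzz
  have hpq : ∀ d : Fin 2 → Circle, (phaseGate d)⁻¹ = phaseGate fun i => (d i)⁻¹ := by
    intro d
    apply inv_eq_of_mul_eq_one_left
    apply Subtype.ext
    simp only [Submonoid.coe_mul, phaseGate_val, Matrix.diagonal_mul_diagonal]
    rw [Submonoid.coe_one, ← Matrix.diagonal_one]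
    congr 1
    ext i
    simp
  have hqz : ∀ d : Fin 2 → Circle, (gateZ * phaseGate d) = phaseGate fun i => ![1, -1] i * d i := by
    intro d
    apply Subtype.ext
    simp only [gateZ, Submonoid.coe_mul, phaseGate_val, Matrix.diagonal_mul_diagonal]
    rfl
  have hrz := rot_half_Z θ
  rw [hst] at h hrz
  -- The required form means `a b⁻¹ = P (v Z v⁻¹) Q⁻¹`. Euler angles of `a b⁻¹`, with `Z Z = 1`
  -- inserted before the right phase, give `v` as the rotation by half the angle and `Q⁻¹ = Z q`;
  -- then `u` is solved from the equation for `a`.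
  refine ⟨p, fun i => (![1, -1] i * q i)⁻¹, (rotU (θ / 2))⁻¹ * (phaseGate p)⁻¹ * a, rotU (θ / 2),
    by group, ?_⟩
  have h2 : a * b⁻¹ = phaseGate p * (rotU (θ / 2) * gateZ * (rotU (θ / 2))⁻¹) *
      (gateZ * phaseGate q) := by
    rw [← hrz, h]
    simp only [mul_assoc]
    rw [← mul_assoc gateZ gateZ, hzz, one_mul]
  have h3 : b = (a * b⁻¹)⁻¹ * a := by group
  rw [h3, h2, hqz, ← hpq]
  simp only [mul_inv_rev, inv_inv, hinv, mul_assoc]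

theorem exists_hadamard : ∃ h : Matrix.unitaryGroup (Fin 2) ℂ,
    h.1 * h.1 = 1 ∧ h.1 * pauliX * h.1 = pauliZ ∧ h.1 * pauliZ * h.1 = pauliX := by
  set r : ℂ := ((Real.sqrt 2 / 2 : ℝ) : ℂ) with hr
  have hrr : r * r = 1 / 2 := by
    rw [hr, ← Complex.ofReal_mul]
    have : Real.sqrt 2 / 2 * (Real.sqrt 2 / 2) = 1 / 2 := by
      nlinarith [Real.mul_self_sqrt (show (0 : ℝ) ≤ 2 by norm_num)]
    rw [this]; norm_num
  have hstar : (starRingEnd ℂ) r = r := Complex.conj_ofReal _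
  set Hm : Matrix (Fin 2) (Fin 2) ℂ := !![r, r; r, -r] with hHm
  have hH2 : Hm * Hm = 1 := by
    ext i j
    fin_cases i <;> fin_cases j <;>
      simp [hHm, Matrix.mul_apply, Fin.sum_univ_two, hrr] <;> norm_num
  have hH : Hm ∈ Matrix.unitaryGroup (Fin 2) ℂ := by
    rw [Matrix.mem_unitaryGroup_iff']
    have : star Hm = Hm := by
      ext i j
      fin_cases i <;> fin_cases j <;> simp [hHm, Matrix.star_apply, hstar]
    rw [this, hH2]
  refine ⟨⟨Hm, hH⟩, hH2, ?_, ?_⟩ <;>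
  · ext i j
    fin_cases i <;> fin_cases j <;>
      simp [hHm, pauliX, pauliZ, Matrix.mul_apply, Fin.sum_univ_two, hrr] <;> norm_num

theorem synth_controlled_Z (c t : Fin N) (h : c ≠ t) :
    Synth (uc t fun y : Bits N => if y c = 0 then 1 else pauliZ) 1 := by
  obtain ⟨H, hH2, hHX, -⟩ := exists_hadamard
  have h1 := ((Synth.single t H 0).mul (Synth.cnot c t h)).mul (Synth.single t H 0)
  rw [single_toMatrix, cnot_toMatrix_eq_uc, uc_mul t ((dependsOn_const _).mono (by simp)),
    uc_mul t] at h1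
  · refine (congrArg (Synth · _) (uc_congr t fun y => ?_)).mp h1
    rcases (show y c = 0 ∨ y c = 1 by generalize y c = z; revert z; decide) with h | h
    · simp [h, xpow_zero, hH2]
    · simp [h, xpow_one, hHX]
  · exact (dependsOn_apply (show c ∈ ({t}ᶜ : Set (Fin N)) by simpa using h)).comp_left
      fun z => H.1 * xpow z

/-- A uniformly controlled unitary, up to a diagonal. -/
theorem exists_diagonal_mul_synth_uc (t : Fin N) (s : Finset (Fin N)) (ht : t ∉ s)
    (f : Bits N → Matrix.unitaryGroup (Fin 2) ℂ) (hf : DependsOn f (s : Set (Fin N))) :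
    ∃ (d : Bits N → Circle) (M : Matrix (Bits N) (Bits N) ℂ),
      DependsOn d (insert t (s : Set (Fin N))) ∧ Synth M (2 ^ s.card - 1) ∧
      uc t (fun y => (f y).1) = (Matrix.diagonal fun y => (d y : ℂ)) * M := by
  induction s using Finset.induction_on generalizing f with
  | empty =>
    refine ⟨fun _ => 1, uc t (fun y => (f y).1), (dependsOn_const _).mono (by simp), ?_, by simp⟩
    have h : ∀ y, f y = f 0 := fun y => hf (by simp)
    simp only [h]
    exact Synth.single t (f 0) _
  | insert c s hc ih =>
    simp only [Finset.mem_insert, not_or] at ht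
    have hct : c ≠ t := Ne.symm ht.1
    have hst : (s : Set (Fin N)) ⊆ {t}ᶜ := by
      intro i hi
      simp only [Set.mem_compl_iff, Set.mem_singleton_iff]
      rintro rfl
      exact ht.2 hi
    have hctm : c ∈ ({t}ᶜ : Set (Fin N)) := by simpa using hct
    rw [Finset.coe_insert] at hf
    choose P Q u v hP hQ using exists_demultiplex
    set f₀ : Bits N → _ := fun y => f (Function.update y c 0) with hf₀
    set f₁ : Bits N → _ := fun y => f (Function.update y c 1) with hf₁
    have h₀ : DependsOn f₀ (s : Set (Fin N)) := hf.update_insert 0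
    have h₁ : DependsOn f₁ (s : Set (Fin N)) := hf.update_insert 1
    -- The rightmost factor `u` is synthesized up to a diagonal `d₁`, which is merged into `v`
    -- before the second recursive call. Fixing the target bit in `d₁` leaves a dependence on `s`
    -- only.
    obtain ⟨d₁, M₁, hd₁, hM₁, e₁⟩ := ih ht.2 (fun y => u (f₀ y) (f₁ y)) (h₀.comp_left₂ h₁ u)
    have hv' : DependsOn (fun y => v (f₀ y) (f₁ y) * phaseGate fun b => d₁ (Function.update y t b))
        (s : Set (Fin N)) := by
      refine (h₀.comp_left₂ h₁ v).comp_left₂ (g := fun y b => d₁ (Function.update y t b)) ?_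
        fun x z => x * phaseGate z
      intro x y h
      funext b
      exact hd₁.update_insert b h
    obtain ⟨d₂, M₂, hd₂, hM₂, e₂⟩ := ih ht.2 _ hv'
    set D : Bits N → Circle := fun y =>
      if y c = 0 then P (f₀ y) (f₁ y) (y t) else Q (f₀ y) (f₁ y) (y t) with hD
    have hfc : ∀ y, f y = if y c = 0 then f₀ y else f₁ y := by
      intro y
      have h1 : Function.update y c (y c) = y := by simp
      rcases (show y c = 0 ∨ y c = 1 by generalize y c = z; revert z; decide) with h | h
      · rw [h] at h1
        simp [h, hf₀, h1]
      · rw [h] at h1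
        simp [h, hf₁, h1]
    set CZ : Matrix (Bits N) (Bits N) ℂ := uc t fun y => if y c = 0 then 1 else pauliZ with hCZ
    have h₀t : ∀ y b, f₀ (Function.update y t b) = f₀ y := fun y b => h₀ (by
      intro i hi; have : i ≠ t := by rintro rfl; exact ht.2 hi
      simp [this])
    have h₁t : ∀ y b, f₁ (Function.update y t b) = f₁ y := fun y b => h₁ (by
      intro i hi; have : i ≠ t := by rintro rfl; exact ht.2 hi
      simp [this])
    have hCZd : DependsOn (fun y : Bits N => if y c = 0 then 1 else pauliZ) {t}ᶜ :=
      (dependsOn_apply hctm).comp_left fun z : Fin 2 => if z = 0 then 1 else pauliZ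
    have hZ : pauliZ = gateZ.1 := by
      rw [gateZ, phaseGate_val, pauliZ]
      ext i j
      fin_cases i <;> fin_cases j <;> simp
    have step1 : uc t (fun y => (f y).1) = (Matrix.diagonal fun y => (D y : ℂ)) *
        (uc t (fun y => (v (f₀ y) (f₁ y)).1) * CZ * uc t (fun y => (u (f₀ y) (f₁ y)).1)) := by
      rw [hCZ, uc_mul t (((h₀.comp_left₂ h₁ v).mono hst).comp_left Subtype.val), uc_mul t,
        diagonal_mul_uc]
      · refine uc_congr t fun y => ?_
        rw [hfc]
        simp only [hD, h₀t, h₁t, Function.update_self, Function.update_of_ne hct]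
        by_cases h : y c = 0
        · simp only [if_pos h, mul_one]
          conv_lhs => rw [hP (f₀ y) (f₁ y)]
          simp only [Submonoid.coe_mul, phaseGate_val, mul_assoc]
        · simp only [if_neg h]
          conv_lhs => rw [hQ (f₀ y) (f₁ y)]
          simp only [Submonoid.coe_mul, phaseGate_val, mul_assoc, hZ]
      · exact (((h₀.comp_left₂ h₁ v).mono hst).comp_left Subtype.val).comp_left₂ hCZd (· * ·)
    -- The controlled `Z` is used instead of a CNOT because it is diagonal and lets `d₁` pass.
    have step2 : uc t (fun y => (v (f₀ y) (f₁ y)).1) * CZ * uc t (fun y => (u (f₀ y) (f₁ y)).1) =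
        uc t (fun y => (v (f₀ y) (f₁ y) * phaseGate fun b => d₁ (Function.update y t b)).1) * CZ *
          M₁ := by
      have comm : CZ * (Matrix.diagonal fun y => (d₁ y : ℂ)) =
          (Matrix.diagonal fun y => (d₁ y : ℂ)) * CZ := by
        rw [hCZ, uc_mul_diagonal, diagonal_mul_uc]
        refine uc_congr t fun y => ?_
        split_ifs
        · rw [one_mul, mul_one]
        · rw [hZ, gateZ, phaseGate_val, Matrix.diagonal_mul_diagonal, Matrix.diagonal_mul_diagonal]
          congr 1
          ext
          rw [mul_comm]
      rw [e₁, ← mul_assoc, mul_assoc _ CZ, comm, ← mul_assoc, uc_mul_diagonal]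
      rfl
    refine ⟨fun y => D y * d₂ y, M₂ * CZ * M₁, ?_, ?_, ?_⟩
    · refine DependsOn.comp_left₂ ?_ (hd₂.mono ?_) (· * ·)
      · intro x y h
        have hc' : x c = y c := h c (by simp)
        have ht' : x t = y t := h t (by simp)
        have hs' : ∀ i ∈ (s : Set (Fin N)), x i = y i := fun i hi => h i (by
          rw [Finset.coe_insert]; exact Or.inr (Or.inr hi))
        simp only [hD, hc', ht', h₀ hs', h₁ hs']
      · rw [Finset.coe_insert]
        intro i hi
        rcases hi with hi | hi
        · exact Or.inl hi
        · exact Or.inr (Or.inr hi)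
    · refine ((hM₂.mul (synth_controlled_Z c t hct)).mul hM₁).mono ?_
      rw [Finset.card_insert_of_notMem hc, pow_succ]
      have : 0 < 2 ^ s.card := by positivity
      omega
    · rw [step1, step2, e₂]
      simp only [Circle.coe_mul, ← Matrix.diagonal_mul_diagonal, mul_assoc]

end Unitaries

/-! ### Synthesis of arbitrary unitaries by the cosine-sine decomposition -/

section Multiplexed

variable {P κ : Type*} [Fintype P] [DecidableEq P] [Fintype κ] [DecidableEq κ]

/-- The operator on `ℂ^P ⊗ ℂ² ⊗ ℂ^κ` acting on the last factor by `L p b`. -/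
def selectLast (L : P → Fin 2 → Matrix κ κ ℂ) : Matrix (P × Fin 2 × κ) (P × Fin 2 × κ) ℂ :=
  fun x y => if x.1 = y.1 then if x.2.1 = y.2.1 then L y.1 y.2.1 x.2.2 y.2.2 else 0 else 0

/-- The operator on `ℂ^P ⊗ ℂ² ⊗ ℂ^κ` acting on the middle factor by `F p k`. -/
def selectMiddle (F : P → κ → Matrix (Fin 2) (Fin 2) ℂ) :
    Matrix (P × Fin 2 × κ) (P × Fin 2 × κ) ℂ :=
  fun x y => if x.1 = y.1 then if x.2.2 = y.2.2 then F y.1 y.2.2 x.2.1 y.2.1 else 0 else 0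

theorem selectLast_mem_unitaryGroup (L : P → Fin 2 → Matrix.unitaryGroup κ ℂ) :
    selectLast (fun p b => (L p b).1) ∈ Matrix.unitaryGroup (P × Fin 2 × κ) ℂ := by
  rw [Matrix.mem_unitaryGroup_iff']
  ext ⟨p, b, k⟩ ⟨p', b', k'⟩
  have h := congrFun (congrFun (Matrix.mem_unitaryGroup_iff'.1 (L p b).2) k) k'
  rw [Matrix.mul_apply, Matrix.one_apply] at h
  rw [Matrix.mul_apply, Matrix.one_apply, Fintype.sum_prod_type, Finset.sum_eq_single p,
    Fintype.sum_prod_type, Finset.sum_eq_single b]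
  · simp only [Matrix.star_apply, selectLast, if_true, Prod.mk.injEq]
    by_cases hp : p = p'
    · by_cases hb : b = b'
      · subst hp hb
        simpa [Matrix.star_apply] using h
      · simp [hb]
    · simp [hp]
  · intro c _ hc
    simp [Matrix.star_apply, selectLast, hc]
  · simp
  · intro c _ hc
    simp [Matrix.star_apply, selectLast, hc]
  · simp

/-- A unitary that preserves the first register is block diagonal with unitary blocks, and each
block has its own cosine-sine decomposition. -/
theorem exists_multiplexed_cosine_sine (M : Matrix (P × Fin 2 × κ) (P × Fin 2 × κ) ℂ)
    (hM : M ∈ Matrix.unitaryGroup (P × Fin 2 × κ) ℂ)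
    (h0 : ∀ x y, x.1 ≠ y.1 → M x y = 0) :
    ∃ (L R : P → Fin 2 → Matrix.unitaryGroup κ ℂ) (θ : P → κ → ℝ),
      M = selectLast (fun p b => (L p b).1) * selectMiddle (fun p k => rot (θ p k)) *
        selectLast (fun p b => (R p b).1) := by
  have hU : ∀ p, (Matrix.of fun x y : Fin 2 × κ => M (p, x) (p, y)) ∈
      Matrix.unitaryGroup (Fin 2 × κ) ℂ := by
    intro p
    rw [Matrix.mem_unitaryGroup_iff']
    ext x y
    have h := congrFun (congrFun (Matrix.mem_unitaryGroup_iff'.1 hM) (p, x)) (p, y)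
    rw [Matrix.mul_apply, Fintype.sum_prod_type, Finset.sum_eq_single p] at h
    · rw [Matrix.mul_apply]
      refine Eq.trans h ?_
      simp [Matrix.one_apply]
    · intro c _ hc
      exact Finset.sum_eq_zero fun a _ => by rw [h0 (c, a) (p, y) hc, mul_zero]
    · simp
  choose L R θ h using fun p => exists_cosine_sine _ (hU p)
  refine ⟨L, R, θ, ?_⟩
  ext ⟨p, b, k⟩ ⟨p', b', k'⟩
  by_cases hp : p = p'
  · subst hp
    have := h p b k b' k'
    simp only [Matrix.of_apply] at this
    rw [this]
    simp only [Matrix.mul_apply, Fintype.sum_prod_type, selectLast, selectMiddle]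
    rw [Finset.sum_eq_single p]
    · rw [Finset.sum_eq_single b']
      · refine Finset.sum_congr rfl fun a _ => ?_
        rw [Finset.sum_eq_single p]
        · rw [Finset.sum_eq_single b]
          · simp
          · intro c _ hc
            simp [Ne.symm hc]
          · simp
        · intro c _ hc
          simp [Ne.symm hc]
        · simp
      · intro c _ hc
        simp [hc]
      · simp
    · intro c _ hc
      simp [hc]
    · simp
  · rw [h0 _ _ hp]
    simp only [Matrix.mul_apply, Fintype.sum_prod_type, selectLast, selectMiddle]
    symm
    refine Finset.sum_eq_zero fun q _ => Finset.sum_eq_zero fun c _ => Finset.sum_eq_zero fun a _ => ?_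
    by_cases hq : q = p'
    · subst hq
      rw [Finset.sum_eq_zero, zero_mul]
      intro r _
      refine Finset.sum_eq_zero fun _ _ => Finset.sum_eq_zero fun _ _ => ?_
      by_cases hr : p = r
      · subst hr
        simp [hp]
      · simp [hr]
    · simp [hq]

end Multiplexed

/-! ### Recursion over the qubits for an arbitrary unitary -/

section UnitarySynthesis

variable {N : ℕ}

/-- `M` does not change the bits with index less than `r`. -/
def PreservesBits (r : ℕ) (M : Matrix (Bits N) (Bits N) ℂ) : Prop :=
  ∀ x y, ∀ i : Fin N, i.val < r → x i ≠ y i → M x y = 0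

/-- The bits before `t`, the bit `t`, and the bits after `t`. -/
def splitAt (t : Fin N) :
    Bits N ≃ ({i : Fin N // i < t} → Fin 2) × Fin 2 × ({i : Fin N // t < i} → Fin 2) where
  toFun x := (fun i => x i, x t, fun i => x i)
  invFun z i := if h : i < t then z.1 ⟨i, h⟩ else if h : t < i then z.2.2 ⟨i, h⟩ else z.2.1
  left_inv x := by
    ext1 i
    by_cases h : i < t
    · simp [h]
    · by_cases h' : t < i
      · simp [h, h']
      · have : i = t := le_antisymm (not_lt.1 h') (not_lt.1 h)
        simp [this]
  right_inv z := by
    refine Prod.ext ?_ (Prod.ext ?_ ?_)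
    · funext ⟨i, hi⟩
      simp [hi]
    · simp
    · funext ⟨i, hi⟩
      simp [hi, hi.not_gt]

/-- One level of the recursion: the bits before `t` label the blocks, `t` is the qubit of the
cosine-sine decomposition, and the outer factors preserve one more bit than `M`. -/
theorem exists_preservesBits_uc (t : Fin N) (M : Matrix (Bits N) (Bits N) ℂ)
    (hM : M ∈ Matrix.unitaryGroup (Bits N) ℂ) (h : PreservesBits t.val M) :
    ∃ (A B : Matrix (Bits N) (Bits N) ℂ) (f : Bits N → Matrix.unitaryGroup (Fin 2) ℂ),
      A ∈ Matrix.unitaryGroup (Bits N) ℂ ∧ B ∈ Matrix.unitaryGroup (Bits N) ℂ ∧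
      PreservesBits (t.val + 1) A ∧ PreservesBits (t.val + 1) B ∧ DependsOn f {t}ᶜ ∧
      M = A * uc t (fun y => (f y).1) * B := by
  obtain ⟨L, R, θ, hLR⟩ := exists_multiplexed_cosine_sine
    (Matrix.reindex (splitAt t) (splitAt t) M) (reindex_mem_unitaryGroup _ hM) (by
      intro x y hxy
      obtain ⟨i, hi⟩ := Function.ne_iff.1 hxy
      refine h _ _ i.1 i.2 ?_
      have hit : i.1 < t := i.2
      simpa [splitAt, hit] using hi)
  have pres : ∀ L : ({i : Fin N // i < t} → Fin 2) → Fin 2 →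
      Matrix ({i : Fin N // t < i} → Fin 2) ({i : Fin N // t < i} → Fin 2) ℂ,
      PreservesBits (t.val + 1)
        (Matrix.reindex (splitAt t).symm (splitAt t).symm (selectLast L)) := by
    intro L x y i hi hxy
    change (if _ then if _ then _ else _ else _) = (0 : ℂ)
    rcases Nat.lt_succ_iff_lt_or_eq.1 hi with hi | hi
    · rw [if_neg]
      intro h
      exact hxy (congrFun h ⟨i, hi⟩)
    · obtain rfl : i = t := Fin.ext hi
      rw [if_neg (show ¬ ((splitAt i).symm.symm x).2.1 = ((splitAt i).symm.symm y).2.1 from hxy)]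
      simp
  refine ⟨Matrix.reindex (splitAt t).symm (splitAt t).symm (selectLast fun p b => (L p b).1),
    Matrix.reindex (splitAt t).symm (splitAt t).symm (selectLast fun p b => (R p b).1),
    fun y => rotU (θ (splitAt t y).1 (splitAt t y).2.2),
    reindex_mem_unitaryGroup _ (selectLast_mem_unitaryGroup L),
    reindex_mem_unitaryGroup _ (selectLast_mem_unitaryGroup R), pres _, pres _, ?_, ?_⟩
  · intro x y hxy
    have h1 : (splitAt t x).1 = (splitAt t y).1 := funext fun i => hxy i.1 i.2.ne
    have h2 : (splitAt t x).2.2 = (splitAt t y).2.2 := funext fun i => hxy i.1 i.2.ne'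
    simp only [h1, h2]
  · have hmid : uc t (fun y => (rotU (θ (splitAt t y).1 (splitAt t y).2.2)).1) =
        Matrix.reindex (splitAt t).symm (splitAt t).symm
          (selectMiddle fun p k => rot (θ p k)) := by
      ext x y
      change (if _ then _ else _) = (if _ then if _ then _ else _ else _)
      by_cases hxy : ∀ i, i ≠ t → x i = y i
      · have h1 : (splitAt t x).1 = (splitAt t y).1 := funext fun i => hxy i.1 i.2.ne
        have h2 : (splitAt t x).2.2 = (splitAt t y).2.2 := funext fun i => hxy i.1 i.2.ne'
        rw [if_pos hxy, Equiv.symm_symm, if_pos h1, if_pos h2]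
        rfl
      · rw [if_neg hxy, ← ite_and, if_neg]
        rintro ⟨h1, h2⟩
        refine hxy fun i hi => ?_
        rcases lt_or_gt_of_ne hi with hi | hi
        · exact congrFun h1 ⟨i, hi⟩
        · exact congrFun h2 ⟨i, hi⟩
    rw [hmid]
    simp only [Matrix.reindex_apply, Equiv.symm_symm] at hLR ⊢
    rw [Matrix.submatrix_mul_equiv, Matrix.submatrix_mul_equiv, ← hLR, Matrix.submatrix_submatrix]
    simp

theorem synth_uc_off (t : Fin N) (f : Bits N → Matrix.unitaryGroup (Fin 2) ℂ)
    (hf : DependsOn f {t}ᶜ) :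
    ∃ (d : Bits N → Circle) (M : Matrix (Bits N) (Bits N) ℂ), Synth M (2 ^ (N - 1) - 1) ∧
      uc t (fun y => (f y).1) = (Matrix.diagonal fun y => (d y : ℂ)) * M := by
  obtain ⟨d, M, -, hM, h⟩ := exists_diagonal_mul_synth_uc t {t}ᶜ (by simp) f (by simpa using hf)
  refine ⟨d, M, hM.mono ?_, h⟩
  rw [Finset.card_compl, Finset.card_singleton, Fintype.card_fin]

theorem phase_diagonal_mem_unitaryGroup (d : Bits N → Circle) :
    (Matrix.diagonal fun y => (d y : ℂ)) ∈ Matrix.unitaryGroup (Bits N) ℂ := by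
  rw [Matrix.mem_unitaryGroup_iff', Matrix.star_eq_conjTranspose, Matrix.diagonal_conjTranspose,
    Matrix.diagonal_mul_diagonal, ← Matrix.diagonal_one]
  congr 1
  ext b
  simp [← Circle.coe_inv_eq_conj]

theorem uc_mul_phase_diagonal (t : Fin N) (f : Bits N → Matrix.unitaryGroup (Fin 2) ℂ)
    (hf : DependsOn f {t}ᶜ) (d : Bits N → Circle) :
    ∃ g : Bits N → Matrix.unitaryGroup (Fin 2) ℂ, DependsOn g {t}ᶜ ∧
      uc t (fun y => (f y).1) * (Matrix.diagonal fun y => (d y : ℂ)) =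
        uc t (fun y => (g y).1) := by
  refine ⟨fun y => f y * phaseGate fun b => d (Function.update y t b), ?_, uc_mul_diagonal _ _ _⟩
  refine hf.comp_left₂ (g := fun y b => d (Function.update y t b)) ?_ fun x z => x * phaseGate z
  intro x y h
  funext b
  have : Function.update x t b = Function.update y t b := by
    funext i
    by_cases hi : i = t
    · subst hi; simp
    · simp [hi, h i (by simpa using hi)]
  simp only [this]

/-- A unitary that preserves the first `N - 1 - m` bits, up to a diagonal. -/
theorem exists_diagonal_mul_synth (hN : 1 ≤ N) (m : ℕ) (hm : m < N)
    (M : Matrix (Bits N) (Bits N) ℂ) (hM : M ∈ Matrix.unitaryGroup (Bits N) ℂ)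
    (h : PreservesBits (N - 1 - m) M) :
    ∃ (d : Bits N → Circle) (A : Matrix (Bits N) (Bits N) ℂ),
      Synth A ((2 ^ (m + 1) - 1) * (2 ^ (N - 1) - 1)) ∧
      M = (Matrix.diagonal fun y => (d y : ℂ)) * A := by
  induction m generalizing M with
  | zero =>
    obtain ⟨A, B, f, hA, hB, hA', hB', hf, rfl⟩ :=
      exists_preservesBits_uc ⟨N - 1, by omega⟩ M hM (by simpa using h)
    -- At the last qubit the outer factors preserve every bit, so they are diagonals of phases.
    have hdiag : ∀ C : Matrix (Bits N) (Bits N) ℂ, C ∈ Matrix.unitaryGroup (Bits N) ℂ →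
        PreservesBits (N - 1 + 1) C → ∃ d : Bits N → Circle,
          C = Matrix.diagonal fun y => (d y : ℂ) := by
      intro C hC hC'
      have h0 : ∀ x y, x ≠ y → C x y = 0 := by
        intro x y hxy
        obtain ⟨i, hi⟩ := Function.ne_iff.1 hxy
        exact hC' x y i (by omega) hi
      have h1 : ∀ x, ‖C x x‖ = 1 := by
        intro x
        have h2 : star (C x x) * C x x = 1 := by
          have := congrFun (congrFun (Matrix.mem_unitaryGroup_iff'.1 hC) x) x
          rw [Matrix.mul_apply, Finset.sum_eq_single x, Matrix.one_apply_eq] at this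
          · exact this
          · intro z _ hz
            rw [h0 z x hz, mul_zero]
          · simp
        rw [← pow_left_inj₀ (norm_nonneg _) zero_le_one two_ne_zero, one_pow,
          ← Complex.normSq_eq_norm_sq]
        have := Complex.normSq_eq_conj_mul_self (z := C x x)
        rw [show (starRingEnd ℂ) (C x x) = star (C x x) from rfl, h2] at this
        exact_mod_cast this
      refine ⟨fun x => ⟨C x x, mem_sphere_zero_iff_norm.2 (h1 x)⟩, ?_⟩
      ext x y
      by_cases hxy : x = y
      · subst hxy; simp
      · rw [h0 x y hxy, Matrix.diagonal_apply_ne _ hxy]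
    obtain ⟨d₁, hd₁⟩ := hdiag A hA hA'
    obtain ⟨d₂, hd₂⟩ := hdiag B hB hB'
    obtain ⟨g, hg, hg'⟩ := uc_mul_phase_diagonal _ f hf d₂
    obtain ⟨d, C, hC, hd⟩ := synth_uc_off _ g hg
    refine ⟨fun y => d₁ y * d y, C, by simpa using hC, ?_⟩
    rw [hd₁, hd₂, mul_assoc, hg', hd, ← mul_assoc, Matrix.diagonal_mul_diagonal]
    simp only [Circle.coe_mul]
  | succ m ih =>
    obtain ⟨A, B, f, hA, hB, hA', hB', hf, rfl⟩ :=
      exists_preservesBits_uc ⟨N - 1 - (m + 1), by omega⟩ M hM h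
    have e : N - 1 - (m + 1) + 1 = N - 1 - m := by omega
    simp only [e] at hA' hB'
    -- Diagonals travel to the left: that of `B` enters the uniformly controlled gate, whose own
    -- diagonal enters `A`. The latter stays unitary and preserves the same bits. The number of
    -- uniformly controlled gates thus obeys `g (m + 1) = 2 g m + 1`, so it is `2 ^ (m + 1) - 1`.
    obtain ⟨d₁, B₁, hB₁, e₁⟩ := ih (by omega) B hB hB'
    obtain ⟨g, hg, hg'⟩ := uc_mul_phase_diagonal _ f hf d₁
    obtain ⟨d₂, C, hC, e₂⟩ := synth_uc_off _ g hg
    obtain ⟨d₃, A₁, hA₁, e₃⟩ := ih (by omega) (A * Matrix.diagonal fun y => (d₂ y : ℂ))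
      (mul_mem hA (phase_diagonal_mem_unitaryGroup d₂)) (by
        intro x y i hi hxy
        rw [Matrix.mul_diagonal, hA' x y i hi hxy, zero_mul])
    refine ⟨d₃, A₁ * C * B₁, ((hA₁.mul hC).mul hB₁).mono ?_, ?_⟩
    · have : 2 ^ (m + 1 + 1) - 1 = (2 ^ (m + 1) - 1) + 1 + (2 ^ (m + 1) - 1) := by
        have : 0 < 2 ^ (m + 1) := by positivity
        rw [pow_succ _ (m + 1)]
        omega
      rw [this]
      apply le_of_eq
      ring
    · rw [e₁, ← mul_assoc, mul_assoc A, hg', e₂, ← mul_assoc, e₃]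
      simp only [mul_assoc]

/-- The single diagonal that survives the recursion acts on all `N` qubits and costs `2 ^ N - 2`. -/
theorem synth_unitary (hN : 1 ≤ N) (M : Matrix (Bits N) (Bits N) ℂ)
    (hM : M ∈ Matrix.unitaryGroup (Bits N) ℂ) :
    Synth M (2 ^ N - 2 + (2 ^ N - 1) * (2 ^ (N - 1) - 1)) := by
  obtain ⟨d, A, hA, h⟩ := exists_diagonal_mul_synth hN (N - 1) (by omega) M hM (by
    intro x y i hi
    omega)
  have : Nonempty (Fin N) := ⟨⟨0, by omega⟩⟩
  have hd := synth_diagonal Finset.univ Finset.univ_nonempty d (fun x y h => by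
    rw [funext fun i => h i (by simp)])
  rw [h]
  rw [Finset.card_univ, Fintype.card_fin] at hd
  rw [Nat.sub_add_cancel hN] at hA
  exact hd.mul hA

end UnitarySynthesis

/-! ### Multiply controlled operations with borrowed qubits -/

section Borrowed

variable {N : ℕ}

theorem bit_cases (b : Fin 2) : b = 0 ∨ b = 1 := by
  revert b; decide

/-- Hadamard gates on the target turn the operator into the sign `(-1) ^ (a b t)`, a diagonal on
three qubits, of cost `2 ^ 3 - 2 = 6`. -/
theorem synth_toffoli (a b t : Fin N) (hab : a ≠ b) (hat : a ≠ t) (hbt : b ≠ t) :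
    Synth (permM fun y : Bits N => Function.update y t (y t + y a * y b)) 6 := by
  obtain ⟨H, hH2, -, hHZ⟩ := exists_hadamard
  have hd := synth_diagonal ({a, b, t} : Finset (Fin N)) (by simp)
    (fun y => if y a * y b * y t = 0 then 1 else -1) (by
      intro x y h
      have ha := h a (by simp)
      have hb := h b (by simp)
      have ht := h t (by simp)
      simp only [ha, hb, ht])
  rw [Finset.card_eq_three.2 ⟨a, b, t, hab, hat, hbt, rfl⟩, diagonal_eq_uc t] at hd
  have h1 := ((Synth.single t H 0).mul hd).mul (Synth.single t H 0)
  rw [single_toMatrix, uc_mul t ((dependsOn_const _).mono (by simp)), uc_mul t] at h1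
  · rw [permM_update_eq_uc]
    refine (congrArg (Synth · _) (uc_congr t fun y => ?_)).mp h1
    simp only [Function.update_self, Function.update_of_ne hat, Function.update_of_ne hbt]
    rcases bit_cases (y a * y b) with h | h
    · simp [h, xpow_zero, hH2]
    · rw [h, xpow_one, ← hHZ]
      congr 2
      ext i j
      fin_cases i <;> fin_cases j <;> simp [pauliZ]
  · intro x y h
    have ha : x a = y a := h a (by simpa using hat)
    have hb : x b = y b := h b (by simpa using hbt)
    simp [hat, hbt, ha, hb]

theorem bits_add_self (y : Bits N) : y + y = 0 := by
  funext i
  simp only [Pi.add_apply, Pi.zero_apply]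
  generalize y i = z
  revert z; decide

/-- A ladder of Toffoli gates adds to the qubit `a m` the conjunction of the qubits
`c 0, …, c (m - 1)`, at the expense of adding functions of these qubits to `a 0, …, a (m - 1)`. -/
theorem exists_synth_ladder (c a : ℕ → Fin N) (m : ℕ)
    (ha : ∀ i ≤ m, ∀ j ≤ m, a i = a j → i = j) (hca : ∀ i < m, ∀ j ≤ m, c i ≠ a j) :
    ∃ e : Bits N → Bits N, DependsOn e (c '' Set.Iio m) ∧
      (∀ y, e y (a m) = ∏ j ∈ Finset.range m, y (c j)) ∧
      (∀ y w, (∀ j ≤ m, w ≠ a j) → e y w = 0) ∧ Synth (permM fun y => y + e y) (12 * m) := by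
  induction m with
  | zero =>
    -- The empty conjunction is 1, so the ladder of length 0 is an `X` gate on `a 0`.
    refine ⟨fun _ => Pi.single (a 0) 1, (dependsOn_const _).mono (by simp), by simp, ?_, ?_⟩
    · intro y w h
      simp [h 0 le_rfl]
    · have hX : xpow 1 ∈ Matrix.unitaryGroup (Fin 2) ℂ := by
        rw [Matrix.mem_unitaryGroup_iff']
        have : star (xpow 1) = xpow 1 := by
          rw [xpow_one]
          ext i j
          fin_cases i <;> fin_cases j <;> simp [pauliX, Matrix.star_apply]
        rw [this, xpow_mul_self]
      have h := Synth.single (a 0) ⟨xpow 1, hX⟩ (12 * 0)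
      rw [single_toMatrix, ← permM_update_eq_uc (a 0) fun _ => 1] at h
      convert h using 3 with y
      funext i
      by_cases hi : i = a 0
      · subst hi; simp
      · simp [hi]
  | succ m ih =>
    obtain ⟨e, he, hea, he0, hs⟩ := ih (fun i hi j hj => ha i (by omega) j (by omega))
      (fun i hi j hj => hca i (by omega) j (by omega))
    have hne : ∀ j ≤ m, a (m + 1) ≠ a j := fun j hj h => by
      have := ha (m + 1) le_rfl j (by omega) h
      omega
    have hT := synth_toffoli (a m) (c m) (a (m + 1)) (hca m (by omega) m (by omega)).symm
      (hne m le_rfl).symm (hca m (by omega) (m + 1) le_rfl)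
    have hc0 : ∀ y, e y (c m) = 0 := fun y => he0 y _ fun j hj => hca m (by omega) j (by omega)
    have ha0 : ∀ y, e y (a (m + 1)) = 0 := fun y => he0 y _ hne
    refine ⟨fun y => e y + Pi.single (a (m + 1)) (∏ j ∈ Finset.range (m + 1), y (c j)),
      ?_, ?_, ?_, ?_⟩
    · intro x y h
      have h1 : e x = e y := he fun i hi => h i (by
        obtain ⟨j, hj, rfl⟩ := hi
        exact ⟨j, lt_trans hj (Nat.lt_succ_self m), rfl⟩)
      have h2 : ∏ j ∈ Finset.range (m + 1), x (c j) = ∏ j ∈ Finset.range (m + 1), y (c j) :=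
        Finset.prod_congr rfl fun j hj => h (c j) ⟨j, Finset.mem_range.1 hj, rfl⟩
      simp only [h1, h2]
    · intro y
      simp [ha0]
    · intro y w hw
      have h1 := hw (m + 1) le_rfl
      simp [he0 y w fun j hj => hw j (by omega), h1]
    -- Toffoli gates before and after the shorter ladder add `v z` and `(v + p) z`, where `v` is the
    -- unknown value of `a m`, `z` that of `c m` and `p` the conjunction so far. The sum is `p z`,
    -- whatever `v` was.
    · have h := (hT.mul hs).mul hT
      rw [permM_mul, permM_mul] at h
      refine (h.mono (by omega)).congr_permM ?_
      intro y
      have hey : e (Function.update y (a (m + 1)) (y (a (m + 1)) + y (a m) * y (c m))) = e y :=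
        he fun i hi => by
          obtain ⟨j, hj, rfl⟩ := hi
          have : c j ≠ a (m + 1) := hca j (lt_trans hj (Nat.lt_succ_self m)) _ le_rfl
          simp [this]
      rw [hey]
      funext w
      by_cases hw : w = a (m + 1)
      · subst hw
        simp only [Function.update_self, Pi.add_apply, ha0, hc0, hea,
          Function.update_of_ne (hne m le_rfl).symm,
          Function.update_of_ne (hca m (by omega) (m + 1) le_rfl), Pi.single_eq_same,
          Finset.prod_range_succ]
        generalize y (a (m + 1)) = u, y (a m) = v, y (c m) = z, ∏ j ∈ Finset.range m, y (c j) = p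
        revert u v z p
        decide
      · simp [hw]

/-- Uniformly controlled rotations with additional controls `c 0, …, c (m - 1)`; the qubits
`a 0, …, a (m - 1)` are borrowed, `a m` is the target. -/
theorem synth_controlled_ucRotation {R : ℝ → Matrix.unitaryGroup (Fin 2) ℂ}
    (hR : RotationFamily R) (s : Finset (Fin N)) (c a : ℕ → Fin N) (m : ℕ)
    (ha : ∀ i ≤ m, ∀ j ≤ m, a i = a j → i = j) (hca : ∀ i < m, ∀ j ≤ m, c i ≠ a j)
    (hs : ∀ j ≤ m, a j ∉ s) (θ : Bits N → ℝ) (hθ : DependsOn θ (s : Set (Fin N))) :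
    Synth (uc (a m) fun y =>
        if ∏ j ∈ Finset.range m, y (c j) = 0 then 1 else (R (θ y)).1)
      (2 * 2 ^ s.card + 24 * m) := by
  obtain ⟨e, he, hea, he0, hV⟩ := exists_synth_ladder c a m ha hca
  set t := a m with ht
  set p : Bits N → Fin 2 := fun y => ∏ j ∈ Finset.range m, y (c j) with hp
  have hinv : ∀ y, (fun y => y + e y) ((fun y => y + e y) y) = y := by
    intro y
    have : e (y + e y) = e y := he fun i hi => by
      obtain ⟨j, hj, rfl⟩ := hi
      rw [Pi.add_apply, he0 y (c j) fun k hk => hca j hj k hk, add_zero]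
    simp only [this, add_assoc, bits_add_self, add_zero]
  have hts : t ∉ s := hs m le_rfl
  have hst : (s : Set (Fin N)) ⊆ {t}ᶜ := by
    intro i hi
    simp only [Set.mem_compl_iff, Set.mem_singleton_iff]
    rintro rfl
    exact hts hi
  have hagree : ∀ x y : Bits N, (∀ i, i ≠ t → x i = y i) →
      e x = e y ∧ ∀ i, i ≠ t → (x + e x) i = (y + e y) i := by
    intro x y h
    have h1 : e x = e y := he fun i hi => by
      obtain ⟨j, hj, rfl⟩ := hi
      exact h _ (hca j hj m le_rfl)
    exact ⟨h1, fun i hi => by rw [Pi.add_apply, Pi.add_apply, h1, h i hi]⟩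
  -- The ladder is an involution, so conjugation restores the borrowed qubits; the angle does not
  -- see them, as they are outside `s`. On the target only `X ^ p` remains.
  have hconj : permM (fun y => y + e y) * uc t (fun y => (R (-(θ y / 2))).1) *
      permM (fun y => y + e y) =
      uc t fun y => xpow (p y) * (R (-(θ y / 2))).1 * xpow (p y) := by
    rw [permM_conj hinv]
    ext x y
    simp only [uc]
    by_cases h : ∀ i, i ≠ t → x i = y i
    · obtain ⟨h1, h2⟩ := hagree x y h
      rw [if_pos h, if_pos h2]
      have h3 : θ (y + e y) = θ y := hθ fun i hi => by
        rw [Pi.add_apply, he0 y i fun j hj hij => hs j hj (hij ▸ hi), add_zero]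
      rw [h3, Pi.add_apply, Pi.add_apply, h1, hea]
      generalize (R (-(θ y / 2))).1 = G, x t = u, y t = v
      change G (u + p y) (v + p y) = _
      generalize p y = b
      rcases bit_cases b with rfl | rfl
      · simp [xpow_zero]
      · rw [xpow_one]
        fin_cases u <;> fin_cases v <;>
          simp [pauliX, Matrix.mul_apply, Matrix.vecMul, dotProduct, Fin.sum_univ_two]
    · rw [if_neg h, if_neg]
      intro h'
      apply h
      have h4 := (hagree _ _ h').2
      have hx : x + e x + e (x + e x) = x := hinv x
      have hy : y + e y + e (y + e y) = y := hinv y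
      rwa [hx, hy] at h4
  have h1 := synth_ucRotation hR t s hts (fun y => θ y / 2) (hθ.comp_left fun z => z / 2)
  have h2 := synth_ucRotation hR t s hts (fun y => -(θ y / 2)) (hθ.comp_left fun z => -(z / 2))
  -- The half rotations by `θ / 2` and `-(θ / 2)` cancel when `p = 0`. When `p = 1`, conjugation by
  -- `X` reverses the second and they add up to `θ`.
  have h3 := h1.mul ((hV.mul h2).mul hV)
  rw [hconj, uc_mul t ((hθ.mono hst).comp_left fun z => (R (z / 2)).1)] at h3
  refine (congrArg (Synth · _) (uc_congr t fun y => ?_)).mp (h3.mono (by omega))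
  rw [hR.conj_xpow, neg_neg]
  change _ = if p y = 0 then _ else _
  split_ifs
  · rw [← hR.add, add_neg_cancel, hR.zero]
  · rw [← hR.add, add_halves]

theorem synth_fanout (t : Fin N) (s : Finset (Fin N)) (ht : t ∉ s) :
    Synth (permM fun (y : Bits N) i => if i ∈ s then y i + y t else y i) s.card := by
  induction s using Finset.induction_on with
  | empty =>
    simp only [Finset.notMem_empty, if_false]
    rw [permM_id]
    exact Synth.one _
  | insert c s hc ih =>
    simp only [Finset.mem_insert, not_or] at ht
    have h := (ih ht.2).mul (Synth.cnot t c ht.1)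
    rw [cnot_toMatrix_eq_permM, permM_mul] at h
    rw [Finset.card_insert_of_notMem hc]
    refine h.congr_permM fun y => ?_
    funext i
    by_cases hi : i = c
    · subst hi
      simp [hc]
    · simp [hi, ht.1]

end Borrowed

/-! ### Exponentials of block operators -/

section Exponential

variable {ι κ o : Type*} [Fintype ι] [DecidableEq ι] [Fintype κ] [DecidableEq κ] [Fintype o]

theorem exp_mul_mul_of_mul_eq_one {A B : Matrix ι ι ℂ} (h : A * B = 1) (X : Matrix ι ι ℂ) :
    NormedSpace.exp (A * X * B) = A * NormedSpace.exp X * B :=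
  Matrix.exp_units_conj ⟨A, B, h, mul_eq_one_comm.1 h⟩ X

/-- Reindexing is a continuous algebra isomorphism. The norms are local to the proof, as the
exponential depends on the topology only. -/
theorem exp_submatrix_equiv (e : ι ≃ κ) (X : Matrix κ κ ℂ) :
    NormedSpace.exp (X.submatrix e e) = (NormedSpace.exp X).submatrix e e := by
  let _ : NormedRing (Matrix κ κ ℂ) := Matrix.linftyOpNormedRing
  let _ : NormedAlgebra ℚ (Matrix κ κ ℂ) := Matrix.linftyOpNormedAlgebra
  have hc : CompleteSpace (κ → κ → ℂ) := inferInstance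
  have h : Continuous (Matrix.reindexAlgEquiv ℂ ℂ e.symm) :=
    (continuous_id (X := Matrix κ κ ℂ)).matrix_submatrix e e
  let _ : NormedRing (Matrix ι ι ℂ) := Matrix.linftyOpNormedRing
  exact (@NormedSpace.map_exp (Matrix κ κ ℂ) (Matrix ι ι ℂ) _ _ hc _ _ _ _ _
    (Matrix.reindexAlgEquiv ℂ ℂ e.symm) h X).symm

theorem exp_pi_matrix (F : o → Matrix κ κ ℂ) :
    NormedSpace.exp F = fun i => NormedSpace.exp (F i) := by
  let _ : NormedRing (Matrix κ κ ℂ) := Matrix.linftyOpNormedRing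
  let _ : NormedAlgebra ℚ (Matrix κ κ ℂ) := Matrix.linftyOpNormedAlgebra
  have hc : CompleteSpace (κ → κ → ℂ) := inferInstance
  exact @Pi.exp_def o (fun _ => Matrix κ κ ℂ) _ _ _ (fun _ => hc) F

theorem exp_blockDiagonal_submatrix [DecidableEq o] (e : ι ≃ κ × o) (F : o → Matrix κ κ ℂ) :
    NormedSpace.exp ((Matrix.blockDiagonal F).submatrix e e) =
      (Matrix.blockDiagonal fun i => NormedSpace.exp (F i)).submatrix e e := by
  rw [exp_submatrix_equiv, Matrix.exp_blockDiagonal, exp_pi_matrix]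

/-- With the qubit `t` split off, the operator is block diagonal over the values of the other
qubits, and the exponential is taken blockwise. -/
theorem exp_uc {N : ℕ} (t : Fin N) {f : Bits N → Matrix (Fin 2) (Fin 2) ℂ}
    (hf : DependsOn f {t}ᶜ) :
    NormedSpace.exp (uc t f) = uc t fun y => NormedSpace.exp (f y) := by
  have key : ∀ g : Bits N → Matrix (Fin 2) (Fin 2) ℂ, DependsOn g {t}ᶜ →
      uc t g = (Matrix.blockDiagonal fun p =>
        g ((Equiv.funSplitAt t (Fin 2)).symm (0, p))).submatrix
          (Equiv.funSplitAt t (Fin 2)) (Equiv.funSplitAt t (Fin 2)) := by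
    intro g hg
    ext x y
    rw [Matrix.submatrix_apply, Matrix.blockDiagonal_apply, uc]
    have hiff : (∀ i, i ≠ t → x i = y i) ↔
        (Equiv.funSplitAt t (Fin 2) x).2 = (Equiv.funSplitAt t (Fin 2) y).2 :=
      ⟨fun h => funext fun i => h i.1 i.2, fun h i hi => congrFun h ⟨i, hi⟩⟩
    simp only [hiff]
    split_ifs with h
    · have : g ((Equiv.funSplitAt t (Fin 2)).symm (0, (Equiv.funSplitAt t (Fin 2) x).2)) = g y := by
        apply hg
        intro i hi
        have hi' : i ≠ t := by simpa using hi
        rw [h]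
        simp [Equiv.funSplitAt, Equiv.piSplitAt, hi']
      rw [this]
      rfl
    · rfl
  rw [key f hf, exp_blockDiagonal_submatrix, key _ (hf.comp_left _)]

/-- Diagonalization with the eigenvectors `(1, ±i)` and eigenvalues `±i`. The angle is `-θ` because
`σ₀₁ - σ₁₀` is minus the generator of `rot`. -/
theorem exp_smul_J (θ : ℝ) :
    NormedSpace.exp ((θ : ℂ) • (sigma01 - sigma10)) = rot (-θ) := by
  set A : Matrix (Fin 2) (Fin 2) ℂ := !![1, 1; Complex.I, -Complex.I] with hA
  set B : Matrix (Fin 2) (Fin 2) ℂ := !![1 / 2, -Complex.I / 2; 1 / 2, Complex.I / 2] with hB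
  have hAB : A * B = 1 := by
    ext i j
    fin_cases i <;> fin_cases j <;>
      simp [hA, hB, Matrix.mul_apply, Fin.sum_univ_two] <;> ring_nf
    simp
  have hJ : (θ : ℂ) • (sigma01 - sigma10) =
      A * Matrix.diagonal ![(θ : ℂ) * Complex.I, -((θ : ℂ) * Complex.I)] * B := by
    ext i j
    fin_cases i <;> fin_cases j <;>
      simp [hA, hB, sigma01, sigma10, Matrix.mul_apply, Fin.sum_univ_two,
        Matrix.vecMul_diagonal] <;> ring_nf <;>
      simp [Complex.I_sq]
  have hexp : NormedSpace.exp ![(θ : ℂ) * Complex.I, -((θ : ℂ) * Complex.I)] =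
      ![Complex.exp ((θ : ℂ) * Complex.I), Complex.exp (-((θ : ℂ) * Complex.I))] := by
    rw [Pi.exp_def]
    funext i
    fin_cases i <;> simp [Complex.exp_eq_exp_ℂ]
  rw [hJ, exp_mul_mul_of_mul_eq_one hAB, Matrix.exp_diagonal, hexp, ← neg_mul,
    Complex.exp_mul_I, Complex.exp_mul_I, Complex.cos_neg, Complex.sin_neg]
  ext i j
  fin_cases i <;> fin_cases j <;>
    simp [hA, hB, rot, Matrix.mul_apply, Fin.sum_univ_two, Matrix.vecMul_diagonal] <;>
    ring_nf <;> simp [Complex.I_sq]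

end Exponential

/-! ### Algebra of ordered products -/

section OrderedProducts

variable {ι : Type*} [Fintype ι] [DecidableEq ι]

theorem orderedProd_zero (F : Fin 0 → Matrix ι ι ℂ) : orderedProd F = 1 := by
  simp [orderedProd]

theorem orderedProd_succ {m : ℕ} (F : Fin (m + 1) → Matrix ι ι ℂ) :
    orderedProd F = (orderedProd fun i : Fin m => F i.succ) * F 0 := by
  simp [orderedProd, List.ofFn_succ]

theorem orderedProd_conj {A B : Matrix ι ι ℂ} (h : B * A = 1) {m : ℕ}
    (F : Fin m → Matrix ι ι ℂ) :
    (orderedProd fun i => A * F i * B) = A * orderedProd F * B := by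
  induction m with
  | zero => simp [orderedProd_zero, mul_eq_one_comm.1 h]
  | succ m ih =>
    rw [orderedProd_succ, orderedProd_succ, ih]
    calc _ = A * (orderedProd fun i => F i.succ) * (B * A) * F 0 * B := by
          simp only [mul_assoc]
      _ = _ := by rw [h, mul_one]; simp only [mul_assoc]

theorem orderedProd_one (k : ℕ) : (orderedProd fun _ : Fin k => (1 : Matrix ι ι ℂ)) = 1 := by
  simp [orderedProd]

theorem orderedProd_ite {m : ℕ} (i : Fin m) (F : Fin m → Matrix ι ι ℂ) :
    (orderedProd fun j => if i = j then F j else 1) = F i := by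
  induction m with
  | zero => exact i.elim0
  | succ m ih =>
    rw [orderedProd_succ]
    refine Fin.cases ?_ (fun i => ?_) i
    · simp [Ne.symm (Fin.succ_ne_zero _), orderedProd_one]
    · simpa using ih i fun j => F j.succ

end OrderedProducts

/-! ### Operators that are diagonal in the state register -/

section StateDiagonal

variable {n : ℕ}

/-- `∑ j, |j⟩⟨j| ⊗ F j`. -/
def stateDiag (F : Fin 16 → Matrix (Spatial n) (Spatial n) ℂ) : Matrix (Reg n) (Reg n) ℂ :=
  (Matrix.blockDiagonal F).submatrix (Equiv.prodComm _ _) (Equiv.prodComm _ _)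

theorem stateDiag_apply (F : Fin 16 → Matrix (Spatial n) (Spatial n) ℂ) (x y : Reg n) :
    stateDiag F x y = if x.1 = y.1 then F x.1 x.2 y.2 else 0 := by
  rw [stateDiag, Matrix.submatrix_apply, Matrix.blockDiagonal_apply]
  rfl

theorem stateDiag_mul (F G : Fin 16 → Matrix (Spatial n) (Spatial n) ℂ) :
    stateDiag F * stateDiag G = stateDiag fun i => F i * G i := by
  rw [stateDiag, stateDiag, Matrix.submatrix_mul_equiv, ← Matrix.blockDiagonal_mul]
  rfl

theorem stateDiag_one : stateDiag (n := n) (fun _ => 1) = 1 := by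
  have := Matrix.blockDiagonal_one (m := Spatial n) (o := Fin 16) (α := ℂ)
  rw [stateDiag, show (fun _ : Fin 16 => (1 : Matrix (Spatial n) (Spatial n) ℂ)) = 1 from rfl,
    this, Matrix.submatrix_one_equiv]

theorem exp_stateDiag (F : Fin 16 → Matrix (Spatial n) (Spatial n) ℂ) :
    NormedSpace.exp (stateDiag F) = stateDiag fun i => NormedSpace.exp (F i) :=
  exp_blockDiagonal_submatrix _ _

theorem orderedProd_stateDiag {m : ℕ} (F : Fin m → Fin 16 → Matrix (Spatial n) (Spatial n) ℂ) :
    (orderedProd fun k => stateDiag (F k)) = stateDiag fun i => orderedProd fun k => F k i := by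
  induction m with
  | zero => simp only [orderedProd_zero, stateDiag_one]
  | succ m ih => simp only [orderedProd_succ, ih, stateDiag_mul]

theorem single_kronecker_eq_stateDiag (j : Fin 16) (M : Matrix (Spatial n) (Spatial n) ℂ) :
    Matrix.single j j (1 : ℂ) ⊗ₖ M = stateDiag fun i => if i = j then M else 0 := by
  ext x y
  rw [stateDiag_apply, Matrix.kroneckerMap_apply, Matrix.single_apply]
  by_cases h : x.1 = j
  · by_cases h' : x.1 = y.1
    · simp [← h', h]
    · have : ¬ (j = x.1 ∧ j = y.1) := fun hh => h' (hh.1.symm.trans hh.2)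
      simp [h', this]
  · simp [h, Ne.symm h]

end StateDiagonal

/-! ### Trotter factors in the eigenbasis of each axis -/

namespace Eigendecomposition

variable {ρ : ℝ} {S : Matrix (Fin 6) (Fin 6) ℝ} (E : Eigendecomposition ρ S) {n : ℕ}

theorem conjTranspose_V_mul_V (α : Fin 3) : (E.V α)ᴴ * E.V α = 1 := by
  ext i j
  have := orthonormal_iff_ite.1 (E.φ α).orthonormal i j
  rw [PiLp.inner_apply] at this
  rw [Matrix.mul_apply, Matrix.one_apply, ← this]
  refine Finset.sum_congr rfl fun k _ => ?_
  simp [V, Matrix.conjTranspose_apply, mul_comm]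

theorem V_mul_conjTranspose_V (α : Fin 3) : E.V α * (E.V α)ᴴ = 1 :=
  mul_eq_one_comm.1 (E.conjTranspose_V_mul_V α)

theorem basisChange_mul_dagger (α : Fin 3) :
    E.basisChange n α * E.basisChangeDagger n α = 1 := by
  rw [basisChange, basisChangeDagger, ← Matrix.mul_kronecker_mul, V_mul_conjTranspose_V, one_mul,
    Matrix.one_kronecker_one]

theorem dagger_mul_basisChange (α : Fin 3) :
    E.basisChangeDagger n α * E.basisChange n α = 1 :=
  mul_eq_one_comm.1 (E.basisChange_mul_dagger α)

theorem P_eq (α : Fin 3) (j : Fin 16) :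
    E.P α j = E.V α * Matrix.single j j (1 : ℂ) * (E.V α)ᴴ := by
  ext a b
  rw [Matrix.mul_apply, Finset.sum_eq_single j]
  · rw [Matrix.mul_apply, Finset.sum_eq_single j]
    · simp [P, V, Matrix.vecMulVec_apply, Matrix.conjTranspose_apply]
    · intro c _ hc
      simp [Ne.symm hc]
    · simp
  · intro c _ hc
    rw [Matrix.mul_apply, Finset.sum_eq_zero, zero_mul]
    intro d _
    simp [Ne.symm hc]
  · simp

theorem block_eq_stateDiag (L τ : ℝ) (α : Fin 3) (j : Fin 16) (κ : Fin n) :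
    E.block L τ α j κ = stateDiag fun i => if i = j then E.W L τ α j κ else 1 := by
  ext x y
  rw [block, single_kronecker_eq_stateDiag, Matrix.add_apply, stateDiag_apply, stateDiag_apply,
    Matrix.kroneckerMap_apply, Matrix.sub_apply, Matrix.one_apply, Matrix.single_apply]
  by_cases h' : x.1 = y.1
  · by_cases h : x.1 = j
    · simp [← h', h]
    · simp [← h', h, Ne.symm h]
  · have : ¬ (j = x.1 ∧ j = y.1) := fun hh => h' (hh.1.symm.trans hh.2)
    simp [h', this]

theorem exp_H (L τ : ℝ) (α : Fin 3) (j : Fin 16) (κ : Fin n) :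
    NormedSpace.exp ((-(Complex.I * (τ : ℂ))) • E.H L α j κ) =
      E.basisChange n α * E.block L τ α j κ * E.basisChangeDagger n α := by
  have h : (-(Complex.I * (τ : ℂ))) • E.H L α j κ = E.basisChange n α *
      (Matrix.single j j (1 : ℂ) ⊗ₖ ((E.θ n L τ α j : ℂ) • Saxis α κ)) *
        E.basisChangeDagger n α := by
    rw [basisChange, basisChangeDagger, ← Matrix.mul_kronecker_mul, ← Matrix.mul_kronecker_mul,
      one_mul, mul_one, ← P_eq, H, Matrix.kronecker_smul, Matrix.kronecker_smul, smul_smul]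
    congr 1
    rw [θ]
    push_cast
    linear_combination (-(τ : ℂ) * (E.eig α j / (2 * spacing n L))) * Complex.I_mul_I
  rw [h, exp_mul_mul_of_mul_eq_one (E.basisChange_mul_dagger α), single_kronecker_eq_stateDiag,
    exp_stateDiag, block_eq_stateDiag]
  congr 3
  funext i
  split_ifs
  · rfl
  · exact NormedSpace.exp_zero

theorem U1_eq_orderedProd_calW (L τ : ℝ) :
    E.U1 n L τ = orderedProd fun α : Fin 3 => orderedProd fun j : Fin 16 => E.calW n L τ α j := by
  simp only [U1, calW, exp_H, orderedProd_conj (E.dagger_mul_basisChange _)]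

/-- The cancellation `V† V = 1` between consecutive `j` leaves one basis change and its adjoint per
axis, which is the shape of the circuit. -/
theorem U1_eq_orderedProd (L τ : ℝ) :
    E.U1 n L τ = orderedProd fun α : Fin 3 => E.basisChange n α *
      (orderedProd fun j : Fin 16 => orderedProd fun κ : Fin n => E.block L τ α j κ) *
        E.basisChangeDagger n α := by
  simp only [U1_eq_orderedProd_calW, calW, orderedProd_conj (E.dagger_mul_basisChange _)]

/-- In the sector `i` of the state register all blocks with `j ≠ i` are the identity, so the product
over `j` selects the evolution with index `i`. The product over 16 indices becomes one uniformly
controlled evolution for each `κ`. -/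
theorem orderedProd_block (L τ : ℝ) (α : Fin 3) :
    (orderedProd fun j : Fin 16 => orderedProd fun κ : Fin n => E.block L τ α j κ) =
      orderedProd fun κ : Fin n => stateDiag fun j => E.W L τ α j κ := by
  simp only [block_eq_stateDiag, orderedProd_stateDiag]
  congr 1
  funext i
  have : ∀ j, (orderedProd fun κ : Fin n => if i = j then E.W L τ α j κ else 1) =
      if i = j then (orderedProd fun κ : Fin n => E.W L τ α j κ) else 1 := by
    intro j
    split_ifs
    · rfl
    · exact orderedProd_one n
  simp only [this]
  exact orderedProd_ite i fun j => orderedProd fun κ : Fin n => E.W L τ α j κ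

end Eigendecomposition

/-! ### Wires of the two registers -/

section Wires

variable {n : ℕ}

/-- The wires of the state register. -/
def stateWire (n : ℕ) (q : Fin 4) : Fin (3 * n + 4) := wireEquiv n (Sum.inl q)

/-- The wires of the spatial register. -/
def axisWire (n : ℕ) (β : Fin 3) (i : Fin n) : Fin (3 * n + 4) := wireEquiv n (Sum.inr (β, i))

theorem encode_apply (b : Bits (3 * n + 4)) :
    encode n b = (stateEquiv fun q => b (stateWire n q), fun β i => b (axisWire n β i)) := rfl

theorem forall_wire {p : Fin (3 * n + 4) → Prop} :
    (∀ w, p w) ↔ (∀ q, p (stateWire n q)) ∧ ∀ β i, p (axisWire n β i) := by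
  rw [← (wireEquiv n).forall_congr_right]
  simp [Sum.forall, Prod.forall, stateWire, axisWire]

theorem stateWire_inj {q q' : Fin 4} : stateWire n q = stateWire n q' ↔ q = q' := by
  simp [stateWire]

theorem axisWire_inj {β β' : Fin 3} {i i' : Fin n} :
    axisWire n β i = axisWire n β' i' ↔ β = β' ∧ i = i' := by
  simp [axisWire]

theorem stateWire_ne_axisWire (q : Fin 4) (β : Fin 3) (i : Fin n) :
    stateWire n q ≠ axisWire n β i := by
  simp [axisWire, stateWire]

/-- A gate on 4 qubits as a gate on the state register. -/
def Gate.onState (n : ℕ) : Gate 4 → Gate (3 * n + 4)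
  | .single q U => .single (stateWire n q) U
  | .cnot c t h => .cnot (stateWire n c) (stateWire n t) fun h' => h (stateWire_inj.1 h')

theorem reindex_uc_stateWire (t : Fin 4) (f : Bits 4 → Matrix (Fin 2) (Fin 2) ℂ) :
    Matrix.reindex (encode n) (encode n)
        (uc (stateWire n t) fun y => f fun q => y (stateWire n q)) =
      Matrix.reindex stateEquiv stateEquiv (uc t f) ⊗ₖ 1 := by
  ext x y
  obtain ⟨x, rfl⟩ := (encode n).surjective x
  obtain ⟨y, rfl⟩ := (encode n).surjective y
  rw [Matrix.reindex_apply, Matrix.submatrix_apply, Equiv.symm_apply_apply,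
    Equiv.symm_apply_apply, encode_apply, encode_apply, Matrix.kroneckerMap_apply,
    Matrix.reindex_apply, Matrix.submatrix_apply, Equiv.symm_apply_apply, Equiv.symm_apply_apply,
    Matrix.one_apply, uc, uc]
  have hiff : (∀ i, i ≠ stateWire n t → x i = y i) ↔
      (∀ q, q ≠ t → x (stateWire n q) = y (stateWire n q)) ∧
        (fun β i => x (axisWire n β i)) = fun β i => y (axisWire n β i) := by
    rw [forall_wire]
    refine and_congr ?_ ?_
    · simp only [ne_eq, stateWire_inj]
    · rw [funext_iff]
      simp only [funext_iff]
      exact forall_congr' fun β => forall_congr' fun i =>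
        ⟨fun h => h (stateWire_ne_axisWire t β i).symm, fun h _ => h⟩
  simp only [hiff, ite_and]
  split_ifs <;> simp

theorem Gate.reindex_onState (g : Gate 4) :
    Matrix.reindex (encode n) (encode n) (g.onState n).toMatrix =
      Matrix.reindex stateEquiv stateEquiv g.toMatrix ⊗ₖ 1 := by
  cases g with
  | single q U =>
    rw [Gate.onState, single_toMatrix, single_toMatrix]
    exact reindex_uc_stateWire q fun _ => U.1
  | cnot c t h =>
    rw [Gate.onState, cnot_toMatrix_eq_uc, cnot_toMatrix_eq_uc]
    exact reindex_uc_stateWire t fun y => xpow (y c)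

theorem Circuit.reindex_onState (C : Circuit 4) :
    Matrix.reindex (encode n) (encode n) (Circuit.toMatrix (C.map (Gate.onState n))) =
      Matrix.reindex stateEquiv stateEquiv (Circuit.toMatrix C) ⊗ₖ 1 := by
  induction C with
  | nil =>
    rw [List.map_nil, Circuit.toMatrix_nil, Circuit.toMatrix_nil, Matrix.reindex_apply,
      Matrix.reindex_apply, Matrix.submatrix_one_equiv, Matrix.submatrix_one_equiv,
      Matrix.one_kronecker_one]
  | cons g C ih =>
    have h : ∀ {N : ℕ} (g : Gate N) (C : Circuit N), Circuit.toMatrix (g :: C) =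
        Circuit.toMatrix C * g.toMatrix := fun g C => by simp [Circuit.toMatrix]
    have hg := Gate.reindex_onState (n := n) g
    rw [List.map_cons, h, h]
    simp only [Matrix.reindex_apply] at ih hg ⊢
    rw [← Matrix.submatrix_mul_equiv _ _ _ (encode n).symm, ih, hg,
      ← Matrix.mul_kronecker_mul, Matrix.submatrix_mul_equiv, one_mul]

theorem Circuit.cnotCount_onState (C : Circuit 4) :
    Circuit.cnotCount (C.map (Gate.onState n)) = Circuit.cnotCount C := by
  rw [Circuit.cnotCount, Circuit.cnotCount, List.map_map]
  congr 1
  refine List.map_congr_left fun g _ => ?_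
  cases g <;> rfl

theorem exists_implements_kronecker_one (n : ℕ) (M : Matrix (Fin 16) (Fin 16) ℂ)
    (hM : M ∈ Matrix.unitaryGroup (Fin 16) ℂ) :
    ∃ C : Circuit (3 * n + 4), Implements C (M ⊗ₖ 1) ∧ Circuit.cnotCount C ≤ 119 := by
  obtain ⟨C, hC, hk⟩ := synth_unitary (N := 4) (by norm_num) _
    (reindex_mem_unitaryGroup stateEquiv.symm hM)
  refine ⟨C.map (Gate.onState n), ?_, ?_⟩
  · rw [Implements, Circuit.reindex_onState, hC]
    simp
  · rw [Circuit.cnotCount_onState]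
    exact hk

theorem Synth.exists_implements {U : Matrix (Reg n) (Reg n) ℂ} {k : ℕ}
    (h : Synth (U.submatrix (encode n) (encode n)) k) :
    ∃ C : Circuit (3 * n + 4), Implements C U ∧ Circuit.cnotCount C ≤ k := by
  obtain ⟨C, hC, hk⟩ := h
  exact ⟨C, by rw [Implements, hC]; simp, hk⟩

end Wires

/-! ### Evolution under the difference operators -/

section Evolution

variable {n : ℕ}

theorem bits_prod_ne_zero_iff {ι : Type*} (s : Finset ι) (f : ι → Fin 2) :
    ∏ j ∈ s, f j ≠ 0 ↔ ∀ j ∈ s, f j = 1 := by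
  classical
  induction s using Finset.induction_on with
  | empty => simp
  | insert c s hc ih =>
    rw [Finset.prod_insert hc, Finset.forall_mem_insert, ← ih]
    generalize f c = u, ∏ j ∈ s, f j = v
    revert u v
    decide

theorem sigma01_apply (u v : Fin 2) : sigma01 u v = if u = 0 ∧ v = 1 then 1 else 0 := by
  fin_cases u <;> fin_cases v <;> simp [sigma01]

theorem sigma10_apply (u v : Fin 2) : sigma10 u v = if u = 1 ∧ v = 0 then 1 else 0 := by
  fin_cases u <;> fin_cases v <;> simp [sigma10]

theorem ladder_apply (κ : Fin n) {a b : Matrix (Fin 2) (Fin 2) ℂ} {u v u' v' : Fin 2}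
    (ha : ∀ s t, a s t = if s = u ∧ t = v then 1 else 0)
    (hb : ∀ s t, b s t = if s = u' ∧ t = v' then 1 else 0) (x y : Fin n → Fin 2) :
    ladder κ a b x y = if (∀ i < Fin.rev κ, x i = y i) ∧
      (x (Fin.rev κ) = u ∧ y (Fin.rev κ) = v) ∧ ∀ i, Fin.rev κ < i → x i = u' ∧ y i = v'
      then 1 else 0 := by
  have h : ∀ i, (if i < Fin.rev κ then (1 : Matrix (Fin 2) (Fin 2) ℂ) else
      if i = Fin.rev κ then a else b) (x i) (y i) =
      if (i < Fin.rev κ → x i = y i) ∧ (i = Fin.rev κ → x i = u ∧ y i = v) ∧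
        (Fin.rev κ < i → x i = u' ∧ y i = v') then 1 else 0 := by
    intro i
    rcases lt_trichotomy i (Fin.rev κ) with h | h | h
    · simp [h, h.ne, h.not_gt, Matrix.one_apply]
    · simp [h, ha]
    · simp [h, h.ne', h.not_gt, hb]
  rw [ladder, tensor, Finset.prod_congr rfl fun i _ => h i, Finset.prod_ite_zero]
  simp only [Finset.mem_univ, true_imp_iff, Finset.prod_const_one, forall_and]
  simp only [forall_eq]

/-- The two ladder terms share one support condition: the higher bits agree, and in row and column
every lower bit is the complement of the bit `Fin.rev κ`. This form shows which CNOTs reduce the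
operator to a single qubit. -/
theorem Scell_apply (κ : Fin n) (x y : Fin n → Fin 2) :
    Scell κ x y = if (∀ i < Fin.rev κ, x i = y i) ∧
      (∀ i, Fin.rev κ < i → x i = x (Fin.rev κ) + 1 ∧ y i = y (Fin.rev κ) + 1)
      then (sigma01 - sigma10) (x (Fin.rev κ)) (y (Fin.rev κ)) else 0 := by
  rw [Scell, Matrix.sub_apply, ladder_apply κ sigma01_apply sigma10_apply,
    ladder_apply κ sigma10_apply sigma01_apply, Matrix.sub_apply, sigma01_apply, sigma10_apply]
  rcases bit_cases (x (Fin.rev κ)) with h | h <;> rcases bit_cases (y (Fin.rev κ)) with h' | h' <;>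
    simp [h, h'] <;> split_ifs <;> simp

theorem Saxis_apply (α : Fin 3) (κ : Fin n) (x y : Spatial n) :
    Saxis α κ x y = if ∀ β, β ≠ α → x β = y β then Scell κ (x α) (y α) else 0 := by
  rw [Saxis, tensor]
  have h : ∀ β, (if β = α then Scell κ else 1) (x β) (y β) =
      if β ≠ α → x β = y β then (if β = α then Scell κ (x α) (y α) else 1) else 0 := by
    intro β
    by_cases hβ : β = α
    · subst hβ; simp
    · simp [hβ, Matrix.one_apply]
  rw [Finset.prod_congr rfl fun β _ => h β, Finset.prod_ite_zero]
  simp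

theorem rotationFamily_rotU_neg : RotationFamily fun θ => rotU (-θ) where
  add a b := by
    ext i j
    fin_cases i <;> fin_cases j <;>
      simp [rotU, rot, Matrix.mul_apply, Fin.sum_univ_two, Complex.cos_add, Complex.sin_add,
        -neg_add_rev, neg_add] <;> ring
  conj a := by
    rw [xpow_one]
    ext i j
    fin_cases i <;> fin_cases j <;>
      simp [rotU, rot, pauliX, Matrix.mul_apply, Fin.sum_univ_two]

/-- Adding the bit `t = Fin.rev κ` to all lower bits of the axis turns the condition that they are
complementary to `t` into the condition that they all equal 1. What remains is a rotation of `t`,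
controlled by these bits, with angle selected by the state register. -/
theorem synth_stateDiag_exp (θ : Fin 16 → ℝ) (α : Fin 3) (κ : Fin n) :
    Synth ((stateDiag fun i => NormedSpace.exp ((θ i : ℂ) • Saxis α κ)).submatrix
      (encode n) (encode n)) (32 + 26 * κ.val) := by
  set r := Fin.rev κ with hr
  -- The controls, starting from the least significant bit; only `j < κ` is used, so the default
  -- wire is irrelevant.
  set c : ℕ → Fin (3 * n + 4) := fun j =>
    if h : j < n then axisWire n α (Fin.rev ⟨j, h⟩) else stateWire n 0 with hc
  -- The borrowed qubits are the first `κ` wires of the next axis, taken cyclically. As `κ < n`, one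
  -- axis always supplies enough of them; the default value makes `a κ` the target.
  set a : ℕ → Fin (3 * n + 4) := fun j =>
    if h : j < κ.val then axisWire n (α + 1) ⟨j, h.trans κ.2⟩ else axisWire n α r with ha
  set t := axisWire n α r with ht
  have hα : α + 1 ≠ α := (show ∀ β : Fin 3, β + 1 ≠ β by decide) α
  have hcj : ∀ j (h : j < κ.val), c j = axisWire n α (Fin.rev ⟨j, h.trans κ.2⟩) := fun j h => by
    simp only [hc, dif_pos (h.trans κ.2)]
  have haκ : a κ.val = t := by simp [ha]
  have haj : ∀ j ≤ κ.val, ∀ i, a j = axisWire n α i → i = r := by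
    intro j hj i h
    rcases hj.lt_or_eq with hj | rfl
    · simp only [ha, dif_pos hj, axisWire_inj] at h
      exact absurd h.1 hα
    · rw [haκ, axisWire_inj] at h
      exact h.2.symm
  have hrev : ∀ i : Fin n, r < i ↔ (Fin.rev i).val < κ.val := by
    intro i
    rw [hr, Fin.lt_def, Fin.val_rev, Fin.val_rev]
    omega
  have hcall : ∀ p : Fin (3 * n + 4) → Prop,
      (∀ j < κ.val, p (c j)) ↔ ∀ i, r < i → p (axisWire n α i) := by
    intro p
    constructor
    · intro h i hi
      have h1 := h _ ((hrev i).1 hi)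
      rw [hcj _ ((hrev i).1 hi)] at h1
      rwa [Fin.eta, Fin.rev_rev] at h1
    · intro h j hj
      rw [hcj j hj]
      apply h
      rw [hrev, Fin.rev_rev]
      exact hj
  have hainj : ∀ i ≤ κ.val, ∀ j ≤ κ.val, a i = a j → i = j := by
    intro i hi j hj h
    rcases hi.lt_or_eq with hi | rfl <;> rcases hj.lt_or_eq with hj | rfl
    · simp only [ha, dif_pos hi, dif_pos hj, axisWire_inj, true_and, Fin.mk.injEq] at h
      exact h
    · rw [haκ] at h
      simp only [ha, dif_pos hi, ht, axisWire_inj] at h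
      exact absurd h.1 hα
    · rw [haκ] at h
      simp only [ha, dif_pos hj, ht, axisWire_inj] at h
      exact absurd h.1.symm hα
    · rfl
  have hca : ∀ i < κ.val, ∀ j ≤ κ.val, c i ≠ a j := by
    intro i hi j hj h
    rw [hcj i hi] at h
    have h1 := haj j hj _ h.symm
    rw [hr, Fin.rev_inj] at h1
    have := congrArg Fin.val h1
    simp only at this
    omega
  have has : ∀ j ≤ κ.val, a j ∉ Finset.univ.image (stateWire n) := by
    intro j hj h
    obtain ⟨q, -, hq⟩ := Finset.mem_image.1 h
    simp only [ha] at hq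
    split_ifs at hq
    · exact stateWire_ne_axisWire _ _ _ hq
    · exact stateWire_ne_axisWire _ _ _ hq
  set Θ : Bits (3 * n + 4) → ℝ := fun y => θ (stateEquiv fun q => y (stateWire n q)) with hΘ
  have hΘd : DependsOn Θ (Finset.univ.image (stateWire n) : Set (Fin (3 * n + 4))) := by
    intro x y h
    simp only [hΘ]
    congr 2
    funext q
    exact h _ (by simp)
  set low := (Finset.range κ.val).image c with hlow
  have htl : t ∉ low := by
    intro h
    obtain ⟨j, hj, hjt⟩ := Finset.mem_image.1 h
    exact hca j (Finset.mem_range.1 hj) κ.val le_rfl (hjt.trans haκ.symm)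
  have hmem_low : ∀ β i, axisWire n β i ∈ low ↔ β = α ∧ r < i := by
    intro β i
    constructor
    · intro h
      obtain ⟨j, hj, hjt⟩ := Finset.mem_image.1 h
      have hj := Finset.mem_range.1 hj
      rw [hcj j hj, axisWire_inj] at hjt
      refine ⟨hjt.1.symm, ?_⟩
      rw [← hjt.2, hrev, Fin.rev_rev]
      exact hj
    · rintro ⟨rfl, hi⟩
      have h1 := (hcall (· ∈ low)).1 fun j hj =>
        Finset.mem_image.2 ⟨j, Finset.mem_range.2 hj, rfl⟩
      exact h1 i hi
  have hst_low : ∀ q, stateWire n q ∉ low := by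
    intro q h
    obtain ⟨j, hj, hjt⟩ := Finset.mem_image.1 h
    rw [hcj j (Finset.mem_range.1 hj)] at hjt
    exact stateWire_ne_axisWire _ _ _ hjt.symm
  have hK := (synth_fanout t low htl).mono
    (Finset.card_image_le.trans_eq (Finset.card_range κ.val))
  set K : Bits (3 * n + 4) → Bits (3 * n + 4) :=
    fun y i => if i ∈ low then y i + y t else y i with hKdef
  have hKt : ∀ y, K y t = y t := fun y => if_neg htl
  have hKK : ∀ y, K (K y) = y := by
    intro y
    funext i
    change (if i ∈ low then K y i + K y t else K y i) = y i
    rw [hKt]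
    by_cases hi : i ∈ low
    · rw [if_pos hi, show K y i = y i + y t from if_pos hi, add_assoc,
        show y t + y t = 0 from congrFun (bits_add_self y) t, add_zero]
    · rw [if_neg hi]
      exact if_neg hi
  set p : Bits (3 * n + 4) → Fin 2 := fun y => ∏ j ∈ Finset.range κ.val, y (c j) with hp
  have hpz : ∀ y, p y ≠ 0 ↔ ∀ i, r < i → y (axisWire n α i) = 1 := by
    intro y
    rw [← hcall fun w => y w = 1]
    simp only [hp, bits_prod_ne_zero_iff, Finset.mem_range]
  set g : Bits (3 * n + 4) → Matrix (Fin 2) (Fin 2) ℂ := fun y =>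
    if p y = 0 then 0 else (Θ y : ℂ) • (sigma01 - sigma10) with hg
  have hgd : DependsOn g {t}ᶜ := by
    intro x y h
    have h1 : Θ x = Θ y := hΘd fun i hi => h i (by
      rintro rfl
      exact has κ.val le_rfl (by rw [haκ]; exact_mod_cast hi))
    have h2 : p x = p y := Finset.prod_congr rfl fun j hj => h _ (by
      rw [← haκ]
      exact hca j (Finset.mem_range.1 hj) _ le_rfl)
    simp only [hg, h1, h2]
  -- The generator rather than its exponential is compared entrywise. The exponential follows
  -- because `permM K` is an involution.
  have hgen : (stateDiag fun i => (θ i : ℂ) • Saxis α κ).submatrix (encode n) (encode n) =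
      permM K * uc t g * permM K := by
    rw [permM_conj hKK]
    ext x y
    rw [Matrix.submatrix_apply, stateDiag_apply, encode_apply, encode_apply, Matrix.smul_apply,
      Saxis_apply, Scell_apply, uc]
    simp only [EmbeddingLike.apply_eq_iff_eq]
    have hstate : ∀ z q, K z (stateWire n q) = z (stateWire n q) := fun z q => if_neg (hst_low q)
    have hΘK : Θ (K y) = Θ y := by simp only [hΘ, hstate]
    have hother : ∀ z β i, ¬ (β = α ∧ r < i) → K z (axisWire n β i) = z (axisWire n β i) :=
      fun z β i h => if_neg fun h' => h ((hmem_low β i).1 h')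
    have hlower : ∀ z i, r < i → K z (axisWire n α i) = z (axisWire n α i) + z t :=
      fun z i h => if_pos ((hmem_low α i).2 ⟨rfl, h⟩)
    have hpK : p (K y) ≠ 0 ↔ ∀ i, r < i → y (axisWire n α i) = y t + 1 := by
      rw [hpz]
      refine forall_congr' fun i => forall_congr' fun hi => ?_
      rw [hlower y i hi]
      generalize y (axisWire n α i) = u, y t = v
      revert u v
      decide
    have hag : (∀ i, i ≠ t → K x i = K y i) ↔
        ((fun q => x (stateWire n q)) = fun q => y (stateWire n q)) ∧
        (∀ β, β ≠ α → (fun i => x (axisWire n β i)) = fun i => y (axisWire n β i)) ∧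
        (∀ i < r, x (axisWire n α i) = y (axisWire n α i)) ∧
        ∀ i, r < i → x (axisWire n α i) + x t = y (axisWire n α i) + y t := by
      rw [forall_wire]
      refine and_congr ?_ ?_
      · rw [funext_iff]
        refine forall_congr' fun q => ?_
        rw [hstate, hstate]
        exact ⟨fun h => h (stateWire_ne_axisWire _ _ _), fun h _ => h⟩
      · constructor
        · intro h
          refine ⟨fun β hβ => funext fun i => ?_, fun i hi => ?_, fun i hi => ?_⟩
          · have := h β i (by rw [ht, Ne, axisWire_inj]; exact fun hh => hβ hh.1)
            rwa [hother _ _ _ fun hh => hβ hh.1, hother _ _ _ fun hh => hβ hh.1] at this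
          · have := h α i (by rw [ht, Ne, axisWire_inj]; exact fun hh => hi.ne hh.2)
            rwa [hother _ _ _ fun hh => hi.not_gt hh.2, hother _ _ _ fun hh => hi.not_gt hh.2]
              at this
          · have := h α i (by rw [ht, Ne, axisWire_inj]; exact fun hh => hi.ne' hh.2)
            rwa [hlower _ _ hi, hlower _ _ hi] at this
        · rintro ⟨h1, h2, h3⟩ β i hne
          by_cases hβ : β = α
          · subst hβ
            rcases lt_trichotomy i r with hi | hi | hi
            · rw [hother _ _ _ fun hh => hi.not_gt hh.2, hother _ _ _ fun hh => hi.not_gt hh.2]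
              exact h2 i hi
            · exact absurd (by rw [ht, hi]) hne
            · rw [hlower _ _ hi, hlower _ _ hi]
              exact h3 i hi
          · rw [hother _ _ _ fun hh => hβ hh.1, hother _ _ _ fun hh => hβ hh.1]
            exact congrFun (h1 β hβ) i
    have hbits : ((∀ i, r < i → x (axisWire n α i) + x t = y (axisWire n α i) + y t) ∧
        ∀ i, r < i → y (axisWire n α i) = y t + 1) ↔
        ∀ i, r < i → x (axisWire n α i) = x t + 1 ∧ y (axisWire n α i) = y t + 1 := by
      rw [← forall_and]
      refine forall_congr' fun i => ?_
      rw [← imp_and]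
      refine imp_congr_right fun _ => ?_
      generalize x (axisWire n α i) = u, x t = v, y (axisWire n α i) = u', y t = v'
      revert u v u' v'
      decide
    have hright : (if ∀ i, i ≠ t → K x i = K y i then g (K y) (K x t) (K y t) else 0) =
        if (∀ i, i ≠ t → K x i = K y i) ∧ p (K y) ≠ 0 then
          (Θ y : ℂ) * (sigma01 - sigma10) (x t) (y t) else 0 := by
      simp only [hg, hΘK, hKt, ite_and]
      refine if_congr Iff.rfl ?_ rfl
      by_cases h : p (K y) = 0 <;> simp [h]
    have hcond := and_congr hag hpK
    rw [and_assoc, and_assoc, and_assoc, hbits] at hcond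
    rw [hright, if_congr hcond rfl rfl]
    simp only [ite_and, smul_eq_mul, ← ht, ← hr]
    by_cases h1 : (fun q => x (stateWire n q)) = fun q => y (stateWire n q)
    · rw [if_pos h1, if_pos h1, h1]
      simp only [mul_ite, mul_zero]
      rfl
    · rw [if_neg h1, if_neg h1]
  have hKmul : permM K * permM K = 1 := by
    rw [permM_mul, funext hKK, permM_id]
  have hexp : (stateDiag fun i => NormedSpace.exp ((θ i : ℂ) • Saxis α κ)).submatrix
      (encode n) (encode n) =
      permM K * (uc t fun y => if p y = 0 then 1 else (rotU (-Θ y)).1) * permM K := by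
    rw [← exp_stateDiag, ← exp_submatrix_equiv, hgen, exp_mul_mul_of_mul_eq_one hKmul,
      exp_uc t hgd]
    congr 2
    refine uc_congr t fun y => ?_
    simp only [hg]
    split_ifs
    · exact NormedSpace.exp_zero
    · exact exp_smul_J _
  have hrot := synth_controlled_ucRotation rotationFamily_rotU_neg
    (Finset.univ.image (stateWire n)) c a κ.val hainj hca has Θ hΘd
  rw [haκ] at hrot
  rw [hexp]
  -- Two fans of `κ` CNOTs, and `2 * 2 ^ 4 + 24 κ` for the controlled rotation.
  refine ((hK.mul hrot).mul hK).mono ?_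
  have hcard : (Finset.univ.image (stateWire n)).card ≤ 4 := by
    simpa using Finset.card_image_le (s := Finset.univ) (f := stateWire n)
  have := Nat.pow_le_pow_right (n := 2) (by norm_num) hcard
  omega

/-! ### Assembly of the circuits and their costs -/

theorem Synth.orderedProd {N m : ℕ} {F : Fin m → Matrix (Bits N) (Bits N) ℂ} {k : Fin m → ℕ}
    (h : ∀ i, Synth (F i) (k i)) : Synth (orderedProd F) (∑ i, k i) := by
  induction m with
  | zero =>
    rw [orderedProd_zero]
    exact Synth.one _
  | succ m ih =>
    rw [orderedProd_succ, Fin.sum_univ_succ]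
    exact ((ih fun i => h i.succ).mul (h 0)).mono (add_comm _ _).le

theorem orderedProd_submatrix {ι κ : Type*} [Fintype ι] [DecidableEq ι] [Fintype κ]
    [DecidableEq κ] (e : ι ≃ κ) {m : ℕ} (F : Fin m → Matrix κ κ ℂ) :
    (Elastic.orderedProd F).submatrix e e = Elastic.orderedProd fun i => (F i).submatrix e e := by
  induction m with
  | zero => rw [orderedProd_zero, orderedProd_zero, Matrix.submatrix_one_equiv]
  | succ m ih =>
    rw [orderedProd_succ, orderedProd_succ, ← ih, Matrix.submatrix_mul_equiv]

theorem sum_block_cost (n : ℕ) : ∑ κ : Fin n, (32 + 26 * κ.val) = 13 * n ^ 2 + 19 * n := by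
  induction n with
  | zero => simp
  | succ n ih =>
    rw [Fin.sum_univ_castSucc]
    simp only [Fin.val_castSucc, ih, Fin.val_last]
    ring

theorem Eigendecomposition.exists_implements_blocks {ρ : ℝ} {S : Matrix (Fin 6) (Fin 6) ℝ}
    (E : Eigendecomposition ρ S) (n : ℕ) (L τ : ℝ) (α : Fin 3) :
    ∃ C : Circuit (3 * n + 4), Implements C (Elastic.orderedProd fun j : Fin 16 =>
        Elastic.orderedProd fun κ : Fin n => E.block L τ α j κ) ∧
      Circuit.cnotCount C ≤ 13 * n ^ 2 + 19 * n := by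
  apply Synth.exists_implements
  rw [E.orderedProd_block, orderedProd_submatrix, ← sum_block_cost]
  exact Synth.orderedProd fun κ => synth_stateDiag_exp (fun j => E.θ n L τ α j) α κ

theorem Implements.append {C D : Circuit (3 * n + 4)} {U W : Matrix (Reg n) (Reg n) ℂ}
    (hC : Implements C U) (hD : Implements D W) : Implements (C ++ D) (W * U) := by
  rw [Implements, Matrix.reindex_apply] at *
  rw [Circuit.toMatrix_append, ← Matrix.submatrix_mul_equiv _ _ _ (encode n).symm, hC, hD]

theorem Implements.flatten {m : ℕ} {C : Fin m → Circuit (3 * n + 4)}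
    {U : Fin m → Matrix (Reg n) (Reg n) ℂ} (h : ∀ i, Implements (C i) (U i)) :
    Implements (List.ofFn C).flatten (Elastic.orderedProd U) := by
  induction m with
  | zero =>
    rw [orderedProd_zero, List.ofFn_zero, List.flatten_nil, Implements, Circuit.toMatrix_nil,
      Matrix.reindex_apply, Matrix.submatrix_one_equiv]
  | succ m ih =>
    rw [orderedProd_succ, List.ofFn_succ, List.flatten_cons]
    exact (h 0).append (ih fun i => h i.succ)

end Evolution
end Elastic

end

theorem mainTheorem7 (n : ℕ) (hn : 1 ≤ n) (L ρ τ : ℝ) (hL : 0 < L) (hρ : 0 < ρ)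
    (S : Matrix (Fin 6) (Fin 6) ℝ) (hS : S.PosDef) (E : Elastic.Eigendecomposition ρ S) :
    E.U1 n L τ =
        Elastic.orderedProd (fun α : Fin 3 =>
          Elastic.orderedProd (fun j : Fin 16 => E.calW n L τ α j)) ∧
      ∃ Vdag blocks V : Fin 3 → Elastic.Circuit (3 * n + 4),
        (∀ α, Elastic.Implements (Vdag α) (E.basisChangeDagger n α)) ∧
        (∀ α, Elastic.Implements (blocks α)
          (Elastic.orderedProd fun j : Fin 16 =>
            Elastic.orderedProd fun κ : Fin n => E.block L τ α j κ)) ∧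
        (∀ α, Elastic.Implements (V α) (E.basisChange n α)) ∧
        Elastic.Implements
          (List.ofFn fun α : Fin 3 => Vdag α ++ blocks α ++ V α).flatten (E.U1 n L τ) ∧
        Elastic.Circuit.cnotCount
          (List.ofFn fun α : Fin 3 => Vdag α ++ blocks α ++ V α).flatten
            ≤ 432 * n ^ 2 + 378 := by
  refine ⟨E.U1_eq_orderedProd_calW L τ, ?_⟩
  have hV : ∀ α, E.V α ∈ Matrix.unitaryGroup (Fin 16) ℂ := fun α =>
    Matrix.mem_unitaryGroup_iff'.2 (E.conjTranspose_V_mul_V α)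
  choose Vdag hVdag kVdag using fun α =>
    Elastic.exists_implements_kronecker_one n (E.V α)ᴴ (star (⟨E.V α, hV α⟩ : Matrix.unitaryGroup (Fin 16) ℂ)).2
  choose V hV' kV using fun α => Elastic.exists_implements_kronecker_one n (E.V α) (hV α)
  choose blocks hblocks kblocks using fun α => E.exists_implements_blocks n L τ α
  refine ⟨Vdag, blocks, V, hVdag, hblocks, hV', ?_, ?_⟩
  · rw [E.U1_eq_orderedProd]
    refine Elastic.Implements.flatten fun α => ?_
    rw [mul_assoc]
    exact ((hVdag α).append (hblocks α)).append (hV' α)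
  · simp only [List.ofFn_succ, List.ofFn_zero, List.flatten_cons, List.flatten_nil,
      List.append_nil, Elastic.Circuit.cnotCount_append]
    -- The slack is `144 n² + 126 - (238 + 13 n² + 19 n) = (n - 1) (131 n + 112)`, which is
    -- nonnegative because `n ≥ 1`.
    have h1 : ∀ α, Elastic.Circuit.cnotCount (Vdag α) + Elastic.Circuit.cnotCount (blocks α) +
        Elastic.Circuit.cnotCount (V α) ≤ 144 * n ^ 2 + 126 := by
      intro α
      have := kVdag α
      have := kV α
      have := kblocks α
      nlinarith
    have h0 := h1 0
    have h2 := h1 (Fin.succ 0)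
    have h3 := h1 (Fin.succ (Fin.succ 0))
    omega
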